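/- Fix an integer $K\ge 2$, reals $\epsilon>0$, $B>0$ and a level $\pi\in(0,1)$. Let $\mathcal L$ be the set of probability measures $\eta$ on $\mathbb R$ with $\mathbb E_\eta[|X|^{1+\epsilon}]\le B$, and let $\mathcal M=\mathcal L^K$, with the (product) topology of weak convergence. For a probability measure $\eta$ on $\mathbb R$ with distribution function $F_\eta$ let $x_\pi(\eta)=\min\{z: F_\eta(z)\ge\pi\}$ and $$c_\pi(\eta)=\frac{F_\eta(x_\pi(\eta))-\pi}{1-\pi}\,x_\pi(\eta)+\frac1{1-\pi}\int_{(x_\pi(\eta),\infty)}y\,d\eta(y)$$ (the value-at-risk and the conditional value-at-risk at level $\pi$). For $x\in\mathbb R$ put $$\mathrm{KL}^U_{\inf}(\eta,x)=\inf_{\kappa\in\mathcal L,\ c_\pi(\kappa)\ge x}\mathrm{KL}(\eta,\kappa),\qquad \mathrm{KL}^L_{\inf}(\eta,x)=\inf_{\kappa\in\mathcal L,\ c_\pi(\kappa)\le x}\mathrm{KL}(\eta,\kappa),$$ with values in $[0,\infty]$, where $\inf\emptyset=\infty$. Let $\Sigma_K$ be the probability simplex in $\mathbb R^K$. For $\nu\in\mathcal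 M$ let $j$ be a best arm of $\nu$, i.e. $c_\pi(\nu_j)=\min_a c_\pi(\nu_a)$, and let $$V(\nu)=\sup_{t\in\Sigma_K}\ \min_{a\ne j}\ \inf_{x\le y}\left\{t_j\,\mathrm{KL}^U_{\inf}(\nu_j,y)+t_a\,\mathrm{KL}^L_{\inf}(\nu_a,x)\right\}\qquad(0\cdot\infty=0).$$ Let $t^*(\nu)\subseteq\Sigma_K$ be the set of maximizers $t$ in this problem (if $\nu$ has several best arms, the union over the best arms $j$ of the sets of maximizers). Then $t^*$ is an upper-hemicontinuous correspondence on $\mathcal M$: for every $\nu\in\mathcal M$ the set $t^*(\nu)$ is non-empty, and for every open set $O\supseteq t^*(\nu)$ there is a neighbourhood of $\nu$ in $\mathcal M$ such that $t^*(\nu')\subseteq O$ for all $\nu'$ in it. Moreover, for every $\nu\in\mathcal M$ the set $t^*(\nu)$ is convex. -/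

import Mathlib

open MeasureTheory

noncomputable section

namespace CVaRBandit

/-- The class `𝓛` of probability measures `η` on `ℝ` with `E_η[|X|^(1+ε)] ≤ B`. -/
def momentClass (ε B : ℝ) : Set (ProbabilityMeasure ℝ) :=
  {η | ∫⁻ x, ENNReal.ofReal (|x| ^ (1 + ε)) ∂(η : Measure ℝ) ≤ ENNReal.ofReal B}

/-- The class `𝓜 = 𝓛^K` of bandit problems with `K` arms. As a subset of
`Fin K → ProbabilityMeasure ℝ` it carries the (product) topology of weak convergence. -/
def banditClass (K : ℕ) (ε B : ℝ) : Set (Fin K → ProbabilityMeasure ℝ) :=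
  {ν | ∀ i, ν i ∈ momentClass ε B}

/-- The distribution function `F_η(z) = η((-∞, z])`. -/
def distFun (η : ProbabilityMeasure ℝ) (z : ℝ) : ℝ :=
  (η : Measure ℝ).real (Set.Iic z)

/-- The value-at-risk `x_π(η) = min {z : F_η(z) ≥ π}`, for `π ∈ (0,1)`. -/
def VaR (π : ℝ) (η : ProbabilityMeasure ℝ) : ℝ :=
  sInf {z : ℝ | π ≤ distFun η z}

/-- The conditional value-at-risk
`c_π(η) = (F_η(x_π) - π)/(1-π) * x_π + 1/(1-π) * ∫_{(x_π, ∞)} y dη(y)`.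
The part of a possible atom at `x_π` that lies above the level `π` is counted by the first term,
so the integral is over the open half-line. -/
def CVaR (π : ℝ) (η : ProbabilityMeasure ℝ) : ℝ :=
  (distFun η (VaR π η) - π) / (1 - π) * VaR π η
    + 1 / (1 - π) * ∫ y in Set.Ioi (VaR π η), y ∂(η : Measure ℝ)

/-- `KL_inf^U(η, x)`, the infimum of `KL(η, κ)` over `κ ∈ 𝓛` with `c_π(κ) ≥ x`. -/
def KLinfU (ε B π : ℝ) (η : ProbabilityMeasure ℝ) (x : ℝ) : ENNReal :=
  ⨅ (κ : ProbabilityMeasure ℝ) (_ : κ ∈ momentClass ε B) (_ : x ≤ CVaR π κ),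
    InformationTheory.klDiv (η : Measure ℝ) (κ : Measure ℝ)

/-- `KL_inf^L(η, x)`, the infimum of `KL(η, κ)` over `κ ∈ 𝓛` with `c_π(κ) ≤ x`. -/
def KLinfL (ε B π : ℝ) (η : ProbabilityMeasure ℝ) (x : ℝ) : ENNReal :=
  ⨅ (κ : ProbabilityMeasure ℝ) (_ : κ ∈ momentClass ε B) (_ : CVaR π κ ≤ x),
    InformationTheory.klDiv (η : Measure ℝ) (κ : Measure ℝ)

variable {K : ℕ}

/-- Arm `j` is a best arm of `ν`: it has the smallest CVaR. -/
def IsBestArm (π : ℝ) (ν : Fin K → ProbabilityMeasure ℝ) (j : Fin K) : Prop :=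
  ∀ a, CVaR π (ν j) ≤ CVaR π (ν a)

/-- The objective of the lower-bound problem with best arm `j`:
`min_{a ≠ j} inf_{x ≤ y} (t_j * KL_inf^U(ν_j, y) + t_a * KL_inf^L(ν_a, x))`,
with the convention `0 * ∞ = 0`. -/
def lowerBoundObjective (ε B π : ℝ) (j : Fin K) (ν : Fin K → ProbabilityMeasure ℝ)
    (t : Fin K → ℝ) : ENNReal :=
  ⨅ (a : Fin K) (_ : a ≠ j) (x : ℝ) (y : ℝ) (_ : x ≤ y),
    (ENNReal.ofReal (t j) * KLinfU ε B π (ν j) y + ENNReal.ofReal (t a) * KLinfL ε B π (ν a) x)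

/-- The value `V(ν)` of the lower-bound problem with best arm `j`: the supremum of the objective
over the probability simplex. -/
def lowerBoundValue (ε B π : ℝ) (j : Fin K) (ν : Fin K → ProbabilityMeasure ℝ) : ENNReal :=
  ⨆ t ∈ stdSimplex ℝ (Fin K), lowerBoundObjective ε B π j ν t

/-- The set `t*(ν)` of maximizers in the lower-bound problem `V(ν)`, set up with a best arm `j`
of `ν`. (If there are several best arms, the objective vanishes for each of them.) -/
def optWeights (ε B π : ℝ) (ν : Fin K → ProbabilityMeasure ℝ) : Set (Fin K → ℝ) :=
  {t | t ∈ stdSimplex ℝ (Fin K) ∧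
    ∃ j, IsBestArm π ν j ∧ lowerBoundObjective ε B π j ν t = lowerBoundValue ε B π j ν}

end CVaRBandit

end

open Filter Topology InformationTheory
open scoped ENNReal NNReal BoundedContinuousFunction

noncomputable section

/-! The theorem is a Berge-type maximum argument. If two arms tie for best, taking `x = y` at the
common CVaR makes the objective vanish identically, so every weight is optimal and nothing remains
to prove. Otherwise the best arm `j` is unique, and it stays the unique best arm nearby because CVaR
is weakly continuous on the moment class. For fixed `ν` the objective is an infimum of functions
linear in `t`, hence concave, which gives convexity. The rest follows from two semicontinuity
statements and compactness of the simplex: `eventually_lowerBoundObjective_lt` (upper, jointly in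
`(ν, t)`) and `eventually_lt_lowerBoundObjective` (lower, in `ν` for fixed `t`).

Lower semicontinuity is the soft half. The objective is an infimum of `t_j KL(ν_j, κ) + t_a KL(ν_a,
κ')` over pairs with `c_π(κ') ≤ c_π(κ)`. These pairs form a compact set, since the moment bound
gives tightness and CVaR is continuous. Moreover KL is jointly lower semicontinuous, being a
supremum of weakly continuous functionals (`exists_continuous_lt_klDual`).

Upper semicontinuity is the hard half: a near-optimal `κ` for `η` may have infinite divergence from
a weakly close `η'`. Write `κ = ρ η + σ` with `σ` singular to `η`, replace `ρ` by a continuous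
density `h` bounded below, and transport it: `κ'` is the normalization of `h η' + σ`. Its divergence
is at most `-∫ log h dη'` plus the log of the mass, which is weakly continuous in `η'`
(`eventually_exists_klDiv_lt`). The transport needs slack in the moment and CVaR constraints. Slack
is created by mixing a little of a suitable measure into `κ`, at a cost of only `-log (1 - s)` in
divergence. It is available for levels strictly between the two arms' CVaRs; the other levels are
reduced to these or treated directly. -/

namespace CVaRBandit

/-! ### Variational formula for KL: measurable test functions -/

section Duality

/-- The functional `∫ g dμ - ∫ (e^g - 1) dν` whose supremum over `g` is the Kullback-Leibler
divergence of probability measures. -/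
def klDual {E : Type*} [MeasurableSpace E] (μ ν : Measure E) (g : E → ℝ) : ℝ :=
  ∫ x, g x ∂μ - ∫ x, (Real.exp (g x) - 1) ∂ν

/-- Fenchel-Young: `g ↦ e^g - 1` is the convex conjugate of `klFun`. -/
theorem mul_sub_exp_le_klFun {x : ℝ} (hx : 0 ≤ x) (g : ℝ) :
    x * g - (Real.exp g - 1) ≤ klFun x := by
  unfold klFun
  rcases hx.eq_or_lt with rfl | hx
  · simp [(Real.exp_pos g).le]
  · have h := Real.add_one_le_exp (g - Real.log x)
    rw [Real.exp_sub, Real.exp_log hx, le_div_iff₀ hx] at h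
    linarith

variable {E : Type*} [MeasurableSpace E] {μ ν : Measure E} [IsProbabilityMeasure μ]
  [IsProbabilityMeasure ν] {g : E → ℝ} {C : ℝ}

theorem integrable_of_abs_le (μ : Measure E) [IsFiniteMeasure μ] (hg : Measurable g)
    (hC : ∀ x, |g x| ≤ C) : Integrable g μ :=
  Integrable.of_bound hg.aestronglyMeasurable C (Eventually.of_forall hC)

theorem integrable_exp_of_abs_le (μ : Measure E) [IsFiniteMeasure μ] (hg : Measurable g)
    (hC : ∀ x, |g x| ≤ C) : Integrable (fun x => Real.exp (g x)) μ :=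
  Integrable.of_bound (by fun_prop) (Real.exp C) (Eventually.of_forall fun x => by
    simpa using (abs_le.1 (hC x)).2)

theorem integrable_rnDeriv_mul (hμν : μ ≪ ν) (hg : Measurable g)
    (hC : ∀ x, |g x| ≤ C) : Integrable (fun x => (μ.rnDeriv ν x).toReal * g x) ν :=
  (integrable_rnDeriv_smul_iff hμν).2 (integrable_of_abs_le μ hg hC)

theorem klDual_eq_integral (hμν : μ ≪ ν) (hg : Measurable g) (hC : ∀ x, |g x| ≤ C) :
    klDual μ ν g = ∫ x, ((μ.rnDeriv ν x).toReal * g x - (Real.exp (g x) - 1)) ∂ν := by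
  have h : Integrable (fun x => Real.exp (g x) - 1) ν :=
    (integrable_exp_of_abs_le ν hg hC).sub (integrable_const _)
  rw [integral_sub (integrable_rnDeriv_mul hμν hg hC) h, klDual]
  congr 1
  exact (integral_rnDeriv_smul hμν).symm

theorem ofReal_klDual_le (hg : Measurable g) (hC : ∀ x, |g x| ≤ C) :
    ENNReal.ofReal (klDual μ ν g) ≤ klDiv μ ν := by
  by_cases h : klDiv μ ν = ∞
  · simp [h]
  have h' := h
  rw [← ne_eq, klDiv_ne_top_iff] at h'
  obtain ⟨hμν, hint⟩ := h'
  refine ENNReal.ofReal_le_of_le_toReal ?_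
  rw [klDual_eq_integral hμν hg hC, toReal_klDiv_eq_integral_klFun hμν]
  refine integral_mono ((integrable_rnDeriv_mul hμν hg hC).sub
    ((integrable_exp_of_abs_le ν hg hC).sub (integrable_const _)))
    ((integrable_klFun_rnDeriv_iff hμν).2 hint) fun x => mul_sub_exp_le_klFun (by simp) _

-- A large multiple of the indicator of a `ν`-null set charged by `μ` costs nothing in the
-- exponential term.
omit [IsProbabilityMeasure ν] in
theorem exists_lt_klDual_of_not_ac (h : ¬ μ ≪ ν) (c : ℝ) :
    ∃ g : E → ℝ, Measurable g ∧ (∃ C, ∀ x, |g x| ≤ C) ∧ c < klDual μ ν g := by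
  have : ∃ s, MeasurableSet s ∧ ν s = 0 ∧ μ s ≠ 0 := by
    by_contra! hs
    exact h (Measure.AbsolutelyContinuous.mk fun s hs' h0 => hs s hs' h0)
  obtain ⟨s, hs, hν, hμ⟩ := this
  have hpos : 0 < μ.real s := ENNReal.toReal_pos hμ (measure_ne_top _ _)
  obtain ⟨n, hn⟩ := exists_nat_gt (c / μ.real s)
  refine ⟨s.indicator fun _ => (n : ℝ), measurable_const.indicator hs, ⟨n, fun x => ?_⟩, ?_⟩
  · by_cases hx : x ∈ s <;> simp [hx]
  · have h0 : ∫ x, (Real.exp (s.indicator (fun _ => (n : ℝ)) x) - 1) ∂ν = 0 := by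
      refine integral_eq_zero_of_ae ?_
      have : ∀ᵐ x ∂ν, x ∉ s := measure_eq_zero_iff_ae_notMem.1 hν
      filter_upwards [this] with x hx
      simp [hx]
    rw [klDual, h0, integral_indicator_const _ hs, sub_zero, smul_eq_mul]
    rw [div_lt_iff₀ hpos] at hn
    linarith

theorem clamp_mem {a b x : ℝ} (hab : a ≤ b) : max a (min x b) ∈ Set.Icc a b := by
  constructor <;> simp [hab]

/-- As `a ≤ 1 ≤ b`, the clamped value `c` lies between `x` and `1`, so `x log c ≥ c log c ≥ c - 1`.
This sign is what permits Fatou's lemma for truncated test functions. -/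
theorem mul_log_clamp_nonneg {a b x : ℝ} (ha : 0 < a) (ha1 : a ≤ 1) (hb : 1 ≤ b) :
    0 ≤ x * Real.log (max a (min x b)) - (max a (min x b) - 1) := by
  set c := max a (min x b) with hc
  have hcpos : 0 < c := lt_of_lt_of_le ha (le_max_left _ _)
  have h1 : c * Real.log c ≤ x * Real.log c := by
    rcases eq_or_ne c 1 with h | h
    · simp [h]
    rcases h.lt_or_gt with h | h
    · refine mul_le_mul_of_nonpos_right ?_ (Real.log_nonpos hcpos.le h.le)
      rcases le_total x b with h' | h'
      · simp [hc, h']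
      · have : b ≤ c := by simp [hc, h']
        linarith
    · refine mul_le_mul_of_nonneg_right ?_ (Real.log_nonneg h.le)
      have : c ≤ max a x := max_le_max le_rfl (min_le_left _ _)
      rcases le_max_iff.1 this with h' | h'
      · linarith
      · exact h'
  have h2 := Real.one_sub_inv_le_log_of_pos hcpos
  have h3 : c * (1 - c⁻¹) ≤ c * Real.log c := mul_le_mul_of_nonneg_left h2 hcpos.le
  have h4 : c * (1 - c⁻¹) = c - 1 := by field_simp
  linarith

theorem tendsto_mul_log_clamp {x : ℝ} (hx : 0 ≤ x) :
    Tendsto (fun n : ℕ => x * Real.log (max (1 / ((n : ℝ) + 1)) (min x (n + 1))) -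
      (max (1 / ((n : ℝ) + 1)) (min x (n + 1)) - 1)) atTop (𝓝 (klFun x)) := by
  have h1 : Tendsto (fun n : ℕ => max (1 / ((n : ℝ) + 1)) (min x (n + 1))) atTop (𝓝 x) := by
    have ha : Tendsto (fun n : ℕ => 1 / ((n : ℝ) + 1)) atTop (𝓝 0) :=
      tendsto_one_div_add_atTop_nhds_zero_nat
    have hb : Tendsto (fun n : ℕ => min x ((n : ℝ) + 1)) atTop (𝓝 x) := by
      refine tendsto_const_nhds.congr' ?_
      obtain ⟨N, hN⟩ := exists_nat_gt x
      filter_upwards [eventually_ge_atTop N] with n hn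
      have : (N : ℝ) ≤ n := by exact_mod_cast hn
      rw [min_eq_left (by linarith)]
    simpa [max_eq_right hx] using ha.max hb
  have h2 : klFun x = x * Real.log x - (x - 1) := by unfold klFun; ring
  rw [h2]
  refine Tendsto.sub ?_ (h1.sub_const 1)
  rcases hx.eq_or_lt with rfl | hx
  · simp
  · exact (h1.log hx.ne').const_mul x

/-- The optimal test function is the log of the density of `μ`. It is made bounded by clamping the
density to `[1/(n+1), n+1]`; the integrands are nonnegative and converge to `klFun`, so Fatou
applies. -/
theorem exists_measurable_lt_klDual {c : ℝ≥0∞} (hc : c < klDiv μ ν) :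
    ∃ g : E → ℝ, Measurable g ∧ (∃ C, ∀ x, |g x| ≤ C) ∧ c < ENNReal.ofReal (klDual μ ν g) := by
  by_cases hac : μ ≪ ν
  swap
  · obtain ⟨g, hg, hC, h⟩ := exists_lt_klDual_of_not_ac hac c.toReal
    exact ⟨g, hg, hC, (ENNReal.lt_ofReal_iff_toReal_lt hc.ne_top).2 h⟩
  set ρ : E → ℝ := fun x => (μ.rnDeriv ν x).toReal with hρ
  have hρm : Measurable ρ := (Measure.measurable_rnDeriv μ ν).ennreal_toReal
  set k : ℕ → E → ℝ := fun n x => max (1 / ((n : ℝ) + 1)) (min (ρ x) (n + 1)) with hk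
  have hkm (n : ℕ) : Measurable (k n) := by fun_prop
  have hkpos (n : ℕ) (x : E) : 0 < k n x := lt_of_lt_of_le (by positivity) (le_max_left _ _)
  have hone (n : ℕ) : 1 / ((n : ℝ) + 1) ≤ 1 := by
    rw [div_le_one (by positivity)]; linarith [n.cast_nonneg (α := ℝ)]
  have hone' (n : ℕ) : 1 ≤ (n : ℝ) + 1 := by linarith [n.cast_nonneg (α := ℝ)]
  have hbdd (n : ℕ) (x : E) : |Real.log (k n x)| ≤ Real.log (n + 1) := by
    obtain ⟨h1, h2⟩ := clamp_mem (x := ρ x) ((hone n).trans (hone' n))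
    rw [abs_le]
    constructor
    · rw [← Real.log_inv, ← one_div]
      exact Real.log_le_log (by positivity) h1
    · exact Real.log_le_log (hkpos n x) h2
  rw [klDiv_eq_lintegral_klFun_of_ac hac] at hc
  have hfatou : ∫⁻ x, ENNReal.ofReal (klFun (ρ x)) ∂ν ≤
      liminf (fun n => ∫⁻ x, ENNReal.ofReal (ρ x * Real.log (k n x) - (k n x - 1)) ∂ν) atTop := by
    refine le_trans (le_of_eq ?_) (lintegral_liminf_le fun n => by fun_prop)
    refine lintegral_congr fun x => ?_
    exact (((ENNReal.continuous_ofReal.tendsto _).comp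
      (tendsto_mul_log_clamp (x := ρ x) (by simp [hρ]))).liminf_eq).symm
  obtain ⟨n, hn⟩ := (eventually_lt_of_lt_liminf (hc.trans_le hfatou)).exists
  refine ⟨fun x => Real.log (k n x), by fun_prop, ⟨_, hbdd n⟩, ?_⟩
  rw [klDual_eq_integral hac (by fun_prop) (hbdd n)]
  have he (x : E) : Real.exp (Real.log (k n x)) = k n x := Real.exp_log (hkpos n x)
  simp only [he]
  rwa [ofReal_integral_eq_lintegral_ofReal]
  · have h2 := (integrable_exp_of_abs_le ν (g := fun x => Real.log (k n x)) (by fun_prop) (hbdd n))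
    simp only [he] at h2
    exact (integrable_rnDeriv_mul hac (by fun_prop) (hbdd n)).sub (h2.sub (integrable_const _))
  · exact Eventually.of_forall fun x => mul_log_clamp_nonneg (by positivity) (hone n) (hone' n)

end Duality

/-! ### Continuous test functions and bounds for KL -/

section Continuous

variable {E : Type*} [MetricSpace E] [MeasurableSpace E] [BorelSpace E] {μ ν : Measure E}
  [IsProbabilityMeasure μ] [IsProbabilityMeasure ν]

theorem abs_exp_sub_exp_le {C a b : ℝ} (ha : |a| ≤ C) (hb : |b| ≤ C) :
    |Real.exp a - Real.exp b| ≤ Real.exp C * |a - b| := by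
  wlog h : b ≤ a generalizing a b
  · rw [abs_sub_comm, abs_sub_comm a]
    exact this hb ha (le_of_not_ge h)
  rw [abs_of_nonneg (sub_nonneg.2 (Real.exp_le_exp.2 h)), abs_of_nonneg (sub_nonneg.2 h)]
  have h1 := Real.add_one_le_exp (b - a)
  have h2 : Real.exp b = Real.exp a * Real.exp (b - a) := by rw [← Real.exp_add]; ring_nf
  have h3 : Real.exp a - Real.exp b ≤ Real.exp a * (a - b) := by
    rw [h2]
    nlinarith [Real.exp_pos a]
  exact h3.trans (mul_le_mul_of_nonneg_right (Real.exp_le_exp.2 (abs_le.1 ha).2)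
    (sub_nonneg.2 h))

/-- On functions bounded by `C` the dual functional is Lipschitz for the `L¹(μ + ν)` distance, in
which continuous functions are dense. Clamping to `[-C, C]` keeps the approximant in that range. -/
theorem exists_continuous_lt_klDual {c : ℝ≥0∞} (hc : c < klDiv μ ν) :
    ∃ g : E →ᵇ ℝ, c < ENNReal.ofReal (klDual μ ν g) := by
  obtain ⟨g, hg, ⟨C, hC⟩, hcg⟩ := exists_measurable_lt_klDual hc
  have hc' := (ENNReal.lt_ofReal_iff_toReal_lt hcg.ne_top).1 hcg
  set d := klDual μ ν g - c.toReal with hd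
  have hdpos : 0 < d := by linarith
  have hKpos : 0 < 2 * (1 + Real.exp C) := by positivity
  -- The Lipschitz constant is at most `1 + e^C`, so this accuracy loses at most half of the gap
  -- `d`.
  obtain ⟨f, hf, -⟩ := (integrable_of_abs_le (μ + ν) hg hC).exists_boundedContinuous_integral_sub_le
    (ε := d / (2 * (1 + Real.exp C))) (by positivity)
  by_cases hE : IsEmpty E
  · exact absurd (measure_univ (μ := μ)) (by simp [Set.univ_eq_empty_iff.2 hE])
  rw [not_isEmpty_iff] at hE
  have hC0 : 0 ≤ C := (abs_nonneg _).trans (hC hE.some)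
  have hCC : -C ≤ C := by linarith
  let k : E →ᵇ ℝ := BoundedContinuousFunction.ofNormedAddCommGroup
    (fun x => max (-C) (min (f x) C)) (by fun_prop) C (fun x => abs_le.2 (clamp_mem hCC))
  have hk (x : E) : |k x| ≤ C := abs_le.2 (clamp_mem hCC)
  have hkg (x : E) : |g x - k x| ≤ |g x - f x| := by
    have h1 := abs_le.1 (hC x)
    have h2 : g x = max (-C) (min (g x) C) := by rw [min_eq_left h1.2, max_eq_right h1.1]
    have h3 : k x = max (-C) (min (f x) C) := rfl
    calc |g x - k x| = |max (-C) (min (g x) C) - max (-C) (min (f x) C)| := by rw [← h2, h3]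
      _ ≤ |min (g x) C - min (f x) C| := by
        simpa using abs_max_sub_max_le_max (-C) (min (g x) C) (-C) (min (f x) C)
      _ ≤ |g x - f x| := by
        simpa using abs_min_sub_min_le_max (g x) C (f x) C
  refine ⟨k, (ENNReal.lt_ofReal_iff_toReal_lt hc.ne_top).2 ?_⟩
  have hkm : Measurable k := k.continuous.measurable
  have hint (m : Measure E) [IsFiniteMeasure m] : Integrable (fun x => |g x - f x|) m :=
    ((integrable_of_abs_le m hg hC).sub (f.integrable m)).abs
  have h1 : ∫ x, |g x - f x| ∂(μ + ν) = ∫ x, |g x - f x| ∂μ + ∫ x, |g x - f x| ∂ν :=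
    integral_add_measure (hint μ) (hint ν)
  have h2 : ∫ x, g x ∂μ - ∫ x, k x ∂μ ≤ ∫ x, |g x - f x| ∂μ := by
    rw [← integral_sub (integrable_of_abs_le μ hg hC) (k.integrable μ)]
    exact integral_mono ((integrable_of_abs_le μ hg hC).sub (k.integrable μ)) (hint μ)
      fun x => (le_abs_self _).trans (hkg x)
  have hek : Integrable (fun x => Real.exp (k x) - 1) ν :=
    (integrable_exp_of_abs_le ν hkm hk).sub (integrable_const _)
  have heg : Integrable (fun x => Real.exp (g x) - 1) ν :=
    (integrable_exp_of_abs_le ν hg hC).sub (integrable_const _)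
  have h3 : ∫ x, (Real.exp (k x) - 1) ∂ν - ∫ x, (Real.exp (g x) - 1) ∂ν ≤
      Real.exp C * ∫ x, |g x - f x| ∂ν := by
    rw [← integral_sub hek heg, ← integral_const_mul]
    refine integral_mono (hek.sub heg) ((hint ν).const_mul _) fun x => ?_
    simp only [sub_sub_sub_cancel_right]
    refine (le_abs_self _).trans ((abs_exp_sub_exp_le (hk x) (hC x)).trans ?_)
    rw [abs_sub_comm]
    exact mul_le_mul_of_nonneg_left (hkg x) (Real.exp_pos C).le
  simp only [Real.norm_eq_abs] at hf
  rw [h1, le_div_iff₀ hKpos] at hf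
  have h4 : 0 ≤ ∫ x, |g x - f x| ∂μ := integral_nonneg fun x => abs_nonneg _
  have h5 : 0 ≤ ∫ x, |g x - f x| ∂ν := integral_nonneg fun x => abs_nonneg _
  have h6 : klDual μ ν g - klDual μ ν k ≤
      ∫ x, |g x - f x| ∂μ + Real.exp C * ∫ x, |g x - f x| ∂ν := by
    unfold klDual; linarith
  have := Real.exp_pos C
  nlinarith [mul_nonneg this.le h4, mul_nonneg this.le h5]

/-- Variational criterion for an upper bound of the Kullback-Leibler divergence. -/
theorem klDiv_le_of_forall_klDual_le {c : ℝ} (h : ∀ g : E →ᵇ ℝ, klDual μ ν g ≤ c) :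
    klDiv μ ν ≤ ENNReal.ofReal c := by
  by_contra! hlt
  obtain ⟨g, hg⟩ := exists_continuous_lt_klDual hlt
  exact absurd (ENNReal.ofReal_le_ofReal (h g)) (not_le.2 hg)

theorem integrable_exp_boundedContinuous (m : Measure E) [IsFiniteMeasure m] (g : E →ᵇ ℝ) :
    Integrable (fun x => Real.exp (g x)) m :=
  integrable_exp_of_abs_le m g.continuous.measurable g.norm_coe_le_norm

omit [IsProbabilityMeasure μ] in
theorem klDual_eq (g : E →ᵇ ℝ) :
    klDual μ ν g = ∫ x, g x ∂μ - ∫ x, Real.exp (g x) ∂ν + 1 := by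
  rw [klDual, integral_sub (integrable_exp_boundedContinuous ν g) (integrable_const _)]
  simp
  ring

/-- If `ν` dominates the multiple `r` of `ν'`, then the divergence from `ν` exceeds that from `ν'`
by at most `-log r`. -/
theorem klDiv_le_sub_log {ν' : Measure E} [IsProbabilityMeasure ν'] {r : ℝ} (hr : 0 < r)
    (hle : ENNReal.ofReal r • ν' ≤ ν) (hfin : klDiv μ ν' ≠ ∞) :
    klDiv μ ν ≤ ENNReal.ofReal ((klDiv μ ν').toReal - Real.log r) := by
  refine klDiv_le_of_forall_klDual_le fun g => ?_
  have h1 : r * ∫ x, Real.exp (g x) ∂ν' ≤ ∫ x, Real.exp (g x) ∂ν := by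
    have := integral_mono_measure hle (Eventually.of_forall fun x => (Real.exp_pos (g x)).le)
      (integrable_exp_boundedContinuous ν g)
    rwa [integral_smul_measure, ENNReal.toReal_ofReal hr.le] at this
  -- Shifting the test function by `log r` absorbs the factor `r` in the exponential integral.
  set k : E →ᵇ ℝ := g + BoundedContinuousFunction.const E (Real.log r) with hk
  have h2 := (ENNReal.ofReal_le_iff_le_toReal hfin).1
    (ofReal_klDual_le (μ := μ) (ν := ν') k.continuous.measurable k.norm_coe_le_norm)
  have h3 : ∫ x, k x ∂μ = ∫ x, g x ∂μ + Real.log r := by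
    simp only [hk, BoundedContinuousFunction.add_apply, BoundedContinuousFunction.const_apply]
    rw [integral_add (g.integrable μ) (integrable_const _)]
    simp
  have h4 : ∫ x, Real.exp (k x) ∂ν' = r * ∫ x, Real.exp (g x) ∂ν' := by
    simp only [hk, BoundedContinuousFunction.add_apply, BoundedContinuousFunction.const_apply,
      Real.exp_add, Real.exp_log hr]
    rw [integral_mul_const, mul_comm]
  rw [klDual_eq, h3, h4] at h2
  rw [klDual_eq]
  linarith

/-- If `ν` dominates the measure with density `h` with respect to `μ`, then `KL(μ, ν)` is at most
`-∫ log h dμ`. -/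
theorem klDiv_le_neg_integral_log {h : E →ᵇ ℝ} {δ : ℝ} (hδ : 0 < δ) (hh : ∀ x, δ ≤ h x)
    (hle : μ.withDensity (fun x => ENNReal.ofReal (h x)) ≤ ν) :
    klDiv μ ν ≤ ENNReal.ofReal (-∫ x, Real.log (h x) ∂μ) := by
  refine klDiv_le_of_forall_klDual_le fun g => ?_
  have hpos (x : E) : 0 < h x := hδ.trans_le (hh x)
  have hint : Integrable (fun x => h x * Real.exp (g x)) μ := by
    refine (integrable_exp_boundedContinuous μ g).bdd_mul (c := ‖h‖)
      h.continuous.aestronglyMeasurable (Eventually.of_forall h.norm_coe_le_norm)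
  have h1 : ∫ x, h x * Real.exp (g x) ∂μ ≤ ∫ x, Real.exp (g x) ∂ν := by
    have h2 := integral_mono_measure hle (Eventually.of_forall fun x => (Real.exp_pos (g x)).le)
      (integrable_exp_boundedContinuous ν g)
    rw [integral_withDensity_eq_integral_toReal_smul
      h.continuous.measurable.ennreal_ofReal (by simp)] at h2
    simpa [ENNReal.toReal_ofReal (hpos _).le] using h2
  have hlog : Integrable (fun x => Real.log (h x)) μ := by
    refine Integrable.of_bound
      (Real.measurable_log.comp h.continuous.measurable).aestronglyMeasurable
      (max |Real.log δ| |Real.log ‖h‖|) (Eventually.of_forall fun x => ?_)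
    exact abs_le_max_abs_abs (Real.log_le_log hδ (hh x))
      (Real.log_le_log (hpos x) ((le_abs_self _).trans (h.norm_coe_le_norm x)))
  have h3 : ∫ x, (g x + Real.log (h x) + 1) ∂μ ≤ ∫ x, h x * Real.exp (g x) ∂μ := by
    refine integral_mono (((g.integrable μ).add hlog).add (integrable_const _)) hint fun x => ?_
    have := Real.add_one_le_exp (g x + Real.log (h x))
    rwa [Real.exp_add, Real.exp_log (hpos x), mul_comm (Real.exp _)] at this
  have hgl : Integrable (fun x => g x + Real.log (h x)) μ := (g.integrable μ).add hlog
  rw [integral_add hgl (integrable_const _), integral_add (g.integrable μ) hlog] at h3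
  simp only [integral_const, probReal_univ, smul_eq_mul, mul_one] at h3
  rw [klDual_eq]
  linarith

/-- Joint lower semicontinuity of the Kullback-Leibler divergence for weak convergence. -/
theorem lowerSemicontinuous_klDiv : LowerSemicontinuous
    fun p : ProbabilityMeasure E × ProbabilityMeasure E =>
      klDiv (p.1 : Measure E) (p.2 : Measure E) := by
  intro p c hc
  obtain ⟨g, hg⟩ := exists_continuous_lt_klDual hc
  let k : E →ᵇ ℝ := BoundedContinuousFunction.ofNormedAddCommGroup
    (fun x => Real.exp (g x)) (by fun_prop) (Real.exp ‖g‖) (fun x => by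
      simpa using (le_abs_self _).trans (g.norm_coe_le_norm x))
  have hcont : Continuous fun q : ProbabilityMeasure E × ProbabilityMeasure E =>
      ENNReal.ofReal (klDual (q.1 : Measure E) (q.2 : Measure E) g) := by
    simp_rw [klDual_eq]
    refine ENNReal.continuous_ofReal.comp (Continuous.add (Continuous.sub ?_ ?_) continuous_const)
    · exact (ProbabilityMeasure.continuous_integral_boundedContinuousFunction g).comp
        continuous_fst
    · exact (ProbabilityMeasure.continuous_integral_boundedContinuousFunction k).comp
        continuous_snd
  filter_upwards [hcont.continuousAt.eventually_mem (Ioi_mem_nhds hg)] with q hq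
  exact lt_of_lt_of_le hq (ofReal_klDual_le g.continuous.measurable g.norm_coe_le_norm)

end Continuous

/-! ### Compactness of the moment class -/

section Moments

variable {ε B : ℝ} {η : ProbabilityMeasure ℝ}

theorem continuous_abs_rpow (hε : 0 < ε) : Continuous fun x : ℝ => |x| ^ (1 + ε) :=
  continuous_abs.rpow_const fun _ => Or.inr (by linarith)

theorem integrable_abs_rpow (hε : 0 < ε) (hη : η ∈ momentClass ε B) :
    Integrable (fun x => |x| ^ (1 + ε)) (η : Measure ℝ) :=
  ⟨(continuous_abs_rpow hε).aestronglyMeasurable, by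
    rw [hasFiniteIntegral_iff_ofReal (Eventually.of_forall fun x => by positivity)]
    exact lt_of_le_of_lt hη ENNReal.ofReal_lt_top⟩

theorem integral_abs_rpow_le (hε : 0 < ε) (hB : 0 ≤ B) (hη : η ∈ momentClass ε B) :
    ∫ x, |x| ^ (1 + ε) ∂(η : Measure ℝ) ≤ B := by
  rw [integral_eq_lintegral_of_nonneg_ae (Eventually.of_forall fun x => by positivity)
    (continuous_abs_rpow hε).aestronglyMeasurable]
  exact ENNReal.toReal_le_of_le_ofReal hB hη

theorem mem_momentClass_of_integral_le
    (hint : Integrable (fun x => |x| ^ (1 + ε)) (η : Measure ℝ))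
    (h : ∫ x, |x| ^ (1 + ε) ∂(η : Measure ℝ) ≤ B) : η ∈ momentClass ε B := by
  change ∫⁻ x, ENNReal.ofReal (|x| ^ (1 + ε)) ∂(η : Measure ℝ) ≤ ENNReal.ofReal B
  rw [← ofReal_integral_eq_lintegral_ofReal hint (Eventually.of_forall fun x => by positivity)]
  exact ENNReal.ofReal_le_ofReal h

theorem abs_le_one_add_rpow (hε : 0 < ε) (x : ℝ) : |x| ≤ 1 + |x| ^ (1 + ε) := by
  rcases le_total |x| 1 with h | h
  · linarith [Real.rpow_nonneg (abs_nonneg x) (1 + ε)]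
  · have := Real.rpow_le_rpow_of_exponent_le h (show (1 : ℝ) ≤ 1 + ε by linarith)
    rw [Real.rpow_one] at this
    linarith

theorem integrable_id_of_rpow (hε : 0 < ε) {μ : Measure ℝ} [IsFiniteMeasure μ]
    (h : Integrable (fun x => |x| ^ (1 + ε)) μ) : Integrable (fun x => x) μ :=
  ((integrable_const 1).add h).mono' measurable_id.aestronglyMeasurable
    (Eventually.of_forall fun x => abs_le_one_add_rpow hε x)

theorem integrable_id_of_mem (hε : 0 < ε) (hη : η ∈ momentClass ε B) :
    Integrable (fun x => x) (η : Measure ℝ) :=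
  integrable_id_of_rpow hε (integrable_abs_rpow hε hη)

/-- Monotone convergence. Each truncated condition integrates a bounded continuous function, hence
is weakly closed. -/
theorem mem_momentClass_iff_forall_min (hε : 0 < ε) (hB : 0 ≤ B) : η ∈ momentClass ε B ↔
    ∀ n : ℕ, ∫ x, min (|x| ^ (1 + ε)) (n : ℝ) ∂(η : Measure ℝ) ≤ B := by
  have hint (n : ℕ) : Integrable (fun x => min (|x| ^ (1 + ε)) (n : ℝ)) (η : Measure ℝ) := by
    refine Integrable.of_bound
      ((continuous_abs_rpow hε).min continuous_const).aestronglyMeasurable n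
      (Eventually.of_forall fun x => ?_)
    rw [Real.norm_of_nonneg (by positivity)]
    exact min_le_right _ _
  constructor
  · intro h n
    exact (integral_mono (hint n) (integrable_abs_rpow hε h) fun x => min_le_left _ _).trans
      (integral_abs_rpow_le hε hB h)
  · intro h
    have hlim : Tendsto (fun n : ℕ =>
        ∫⁻ x, ENNReal.ofReal (min (|x| ^ (1 + ε)) (n : ℝ)) ∂(η : Measure ℝ)) atTop
        (𝓝 (∫⁻ x, ENNReal.ofReal (|x| ^ (1 + ε)) ∂(η : Measure ℝ))) := by
      refine lintegral_tendsto_of_tendsto_of_monotone (fun n => by fun_prop)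
        (Eventually.of_forall fun x m n hmn => ?_) (Eventually.of_forall fun x => ?_)
      · exact ENNReal.ofReal_le_ofReal (min_le_min le_rfl (by exact_mod_cast hmn))
      · refine tendsto_const_nhds.congr' ?_
        obtain ⟨N, hN⟩ := exists_nat_gt (|x| ^ (1 + ε))
        filter_upwards [eventually_ge_atTop N] with n hn
        have : (N : ℝ) ≤ n := by exact_mod_cast hn
        rw [min_eq_left (by linarith)]
    refine le_of_tendsto' hlim fun n => ?_
    rw [← ofReal_integral_eq_lintegral_ofReal (hint n)
      (Eventually.of_forall fun x => by positivity)]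
    exact ENNReal.ofReal_le_ofReal (h n)

theorem isClosed_momentClass (hε : 0 < ε) (hB : 0 ≤ B) : IsClosed (momentClass ε B) := by
  have : momentClass ε B =
      ⋂ n : ℕ, {η : ProbabilityMeasure ℝ | ∫ x, min (|x| ^ (1 + ε)) (n : ℝ) ∂(η : Measure ℝ) ≤ B} := by
    ext η
    simp [mem_momentClass_iff_forall_min hε hB]
  rw [this]
  refine isClosed_iInter fun n => isClosed_le ?_ continuous_const
  let k : ℝ →ᵇ ℝ := BoundedContinuousFunction.ofNormedAddCommGroup
    (fun x => min (|x| ^ (1 + ε)) (n : ℝ)) ((continuous_abs_rpow hε).min continuous_const) n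
    (fun x => by
      rw [Real.norm_of_nonneg (by positivity)]
      exact min_le_right _ _)
  exact ProbabilityMeasure.continuous_integral_boundedContinuousFunction k

/-- Markov's inequality bounds the mass outside `[-(n+1), n+1]` by `B / (n+1)^(1+ε)` uniformly, so
the class is tight; it is also closed. -/
theorem isCompact_momentClass (hε : 0 < ε) (hB : 0 ≤ B) : IsCompact (momentClass ε B) := by
  have hu : Tendsto (fun n : ℕ => (B / ((n : ℝ) + 1) ^ (1 + ε)).toNNReal) atTop (𝓝 0) := by
    rw [← Real.toNNReal_zero]
    refine (continuous_real_toNNReal.tendsto 0).comp (Tendsto.const_div_atTop ?_ B)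
    exact (tendsto_rpow_atTop (by linarith)).comp
      (tendsto_atTop_add_const_right _ _ tendsto_natCast_atTop_atTop)
  refine (isCompact_setOfPred_probabilityMeasure_mass_eq_compl_isCompact_le hu
    (K := fun n : ℕ => Set.Icc (-((n : ℝ) + 1)) (n + 1)) (fun n => isCompact_Icc)
    (Or.inl inferInstance)).of_isClosed_subset (isClosed_momentClass hε hB) ?_
  intro η hη n
  have hn : (0 : ℝ) < (n : ℝ) + 1 := by positivity
  have hpow : (0 : ℝ) < ((n : ℝ) + 1) ^ (1 + ε) := by positivity
  rw [← ENNReal.coe_le_coe, ProbabilityMeasure.ennreal_coeFn_eq_coeFn_toMeasure]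
  change _ ≤ ENNReal.ofReal (B / ((n : ℝ) + 1) ^ (1 + ε))
  rw [ENNReal.ofReal_div_of_pos hpow, ENNReal.le_div_iff_mul_le (by simp [hpow]) (by simp)]
  refine le_trans ?_ hη
  rw [mul_comm]
  refine le_trans (mul_le_mul_right (measure_mono fun x hx => ?_) _)
    (mul_meas_ge_le_lintegral (continuous_abs_rpow hε).measurable.ennreal_ofReal
      (ENNReal.ofReal (((n : ℝ) + 1) ^ (1 + ε))))
  refine ENNReal.ofReal_le_ofReal (Real.rpow_le_rpow hn.le ?_ (by linarith))
  by_contra! h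
  exact hx (abs_le.1 h.le)

end Moments

/-! ### CVaR as a minimum over thresholds -/

section RockafellarUryasev

/-- The Rockafellar-Uryasev objective `z + E[(X - z)⁺] / (1 - π)`, whose minimum over `z` is the
conditional value-at-risk. -/
def ruObj (π : ℝ) (η : ProbabilityMeasure ℝ) (z : ℝ) : ℝ :=
  z + (∫ x, max (x - z) 0 ∂(η : Measure ℝ)) / (1 - π)

variable {π : ℝ} {η : ProbabilityMeasure ℝ}

theorem distFun_eq_cdf (η : ProbabilityMeasure ℝ) (z : ℝ) :
    distFun η z = ProbabilityTheory.cdf (η : Measure ℝ) z :=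
  (ProbabilityTheory.cdf_eq_real _ _).symm

theorem isLeast_VaR (hπ0 : 0 < π) (hπ1 : π < 1) (η : ProbabilityMeasure ℝ) :
    IsLeast {z : ℝ | π ≤ distFun η z} (VaR π η) := by
  set F := ProbabilityTheory.cdf (η : Measure ℝ) with hF
  have hset : {z : ℝ | π ≤ distFun η z} = {z | π ≤ F z} := by simp [distFun_eq_cdf, hF]
  have hne : {z | π ≤ F z}.Nonempty := by
    obtain ⟨z, hz⟩ := ((ProbabilityTheory.tendsto_cdf_atTop (η : Measure ℝ)).eventually_mem
      (Ioi_mem_nhds hπ1)).exists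
    exact ⟨z, (Set.mem_Ioi.1 hz).le⟩
  have hbdd : BddBelow {z | π ≤ F z} := by
    obtain ⟨z, hz⟩ := ((ProbabilityTheory.tendsto_cdf_atBot (η : Measure ℝ)).eventually_mem
      (Iio_mem_nhds hπ0)).exists
    refine ⟨z, fun w hw => ?_⟩
    by_contra! h
    exact absurd (lt_of_le_of_lt (F.mono h.le) hz) (not_lt.2 hw)
  have hvar : VaR π η = sInf {z | π ≤ F z} := by rw [VaR, hset]
  rw [hset, hvar]
  refine ⟨?_, fun z hz => csInf_le hbdd hz⟩
  set m := sInf {z | π ≤ F z} with hm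
  have hright : Tendsto F (𝓝[>] m) (𝓝 (F m)) :=
    (F.right_continuous m).tendsto.mono_left (nhdsWithin_mono _ Set.Ioi_subset_Ici_self)
  refine ge_of_tendsto hright ?_
  filter_upwards [self_mem_nhdsWithin] with z hz
  obtain ⟨w, hw, hwz⟩ := exists_lt_of_csInf_lt hne (show sInf {z | π ≤ F z} < z from hz)
  exact le_trans hw (F.mono hwz.le)

theorem le_distFun_VaR (hπ0 : 0 < π) (hπ1 : π < 1) (η : ProbabilityMeasure ℝ) :
    π ≤ distFun η (VaR π η) := (isLeast_VaR hπ0 hπ1 η).1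

/-- Every `z` below the value-at-risk has `F(z) < π`; let `z` increase to it. -/
theorem measureReal_Iio_VaR_le (hπ0 : 0 < π) (hπ1 : π < 1) (η : ProbabilityMeasure ℝ) :
    (η : Measure ℝ).real (Set.Iio (VaR π η)) ≤ π := by
  have hU : Set.Iio (VaR π η) = ⋃ n : ℕ, Set.Iic (VaR π η - 1 / ((n : ℝ) + 1)) := by
    ext x
    simp only [Set.mem_Iio, Set.mem_iUnion, Set.mem_Iic]
    constructor
    · intro hx
      obtain ⟨n, hn⟩ := exists_nat_one_div_lt (sub_pos.2 hx)
      exact ⟨n, by linarith⟩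
    · rintro ⟨n, hn⟩
      have : (0 : ℝ) < 1 / ((n : ℝ) + 1) := by positivity
      linarith
  have hmono : Monotone fun n : ℕ => Set.Iic (VaR π η - 1 / ((n : ℝ) + 1)) := by
    intro m n hmn
    refine Set.Iic_subset_Iic.2 ?_
    have : 1 / ((n : ℝ) + 1) ≤ 1 / ((m : ℝ) + 1) := Nat.one_div_le_one_div hmn
    linarith
  have hlim := tendsto_measure_iUnion_atTop (μ := (η : Measure ℝ)) hmono
  rw [← hU] at hlim
  have hlim' := (ENNReal.tendsto_toReal (measure_ne_top _ _)).comp hlim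
  refine le_of_tendsto' hlim' fun n => ?_
  have hlt : VaR π η - 1 / ((n : ℝ) + 1) < VaR π η := by
    have : (0 : ℝ) < 1 / ((n : ℝ) + 1) := by positivity
    linarith
  by_contra! h
  exact absurd ((isLeast_VaR hπ0 hπ1 η).2 (le_of_lt h)) (not_le.2 hlt)

theorem integrable_posPart {μ : Measure ℝ} [IsFiniteMeasure μ] (h : Integrable (fun x => x) μ)
    (z : ℝ) : Integrable (fun x => max (x - z) 0) μ :=
  (h.sub (integrable_const z)).pos_part

theorem CVaR_eq_ruObj (hπ1 : π < 1) (h : Integrable (fun x => x) (η : Measure ℝ)) :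
    CVaR π η = ruObj π η (VaR π η) := by
  set z := VaR π η with hz
  have h1 : ∫ x, max (x - z) 0 ∂(η : Measure ℝ) =
      ∫ x in Set.Ioi z, x ∂(η : Measure ℝ) - (1 - distFun η z) * z := by
    have : (fun x => max (x - z) 0) = (Set.Ioi z).indicator fun x => x - z := by
      ext x
      by_cases hx : z < x
      · rw [Set.indicator_of_mem (by exact hx), max_eq_left (by linarith)]
      · rw [Set.indicator_of_notMem (by simpa using hx), max_eq_right (by linarith)]
    rw [this, integral_indicator measurableSet_Ioi, integral_sub h.integrableOn (integrable_const _)]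
    congr 1
    rw [setIntegral_const, smul_eq_mul, ← Set.compl_Iic, probReal_compl_eq_one_sub measurableSet_Iic]
    rfl
  have hne : 1 - π ≠ 0 := by linarith
  rw [CVaR, ruObj, h1, ← hz]
  field_simp
  ring

/-- Moving the threshold from `v` down to `z` adds at least `v - z` on `[v, ∞)`, which has mass at
least `1 - π`; moving it up removes at most `z - v` on `(v, ∞)`, which has mass at most `1 - π`.
Either way the change in the linear term is compensated. -/
theorem CVaR_le_ruObj (hπ0 : 0 < π) (hπ1 : π < 1) (h : Integrable (fun x => x) (η : Measure ℝ))
    (z : ℝ) : CVaR π η ≤ ruObj π η z := by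
  rw [CVaR_eq_ruObj hπ1 h]
  set v := VaR π η with hv
  have hpos : 0 < 1 - π := by linarith
  have key : (v - z) * (1 - π) + ∫ x, max (x - v) 0 ∂(η : Measure ℝ) ≤
      ∫ x, max (x - z) 0 ∂(η : Measure ℝ) := by
    rcases le_total z v with hzv | hzv
    · have h1 : 1 - π ≤ (η : Measure ℝ).real (Set.Ici v) := by
        rw [← Set.compl_Iio, probReal_compl_eq_one_sub measurableSet_Iio]
        linarith [measureReal_Iio_VaR_le hπ0 hπ1 η]
      have h2 : ∫ x, ((Set.Ici v).indicator (fun _ => v - z) x + max (x - v) 0) ∂(η : Measure ℝ) ≤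
          ∫ x, max (x - z) 0 ∂(η : Measure ℝ) := by
        refine integral_mono (((integrable_const _).indicator measurableSet_Ici).add
          (integrable_posPart h v)) (integrable_posPart h z) fun x => ?_
        by_cases hx : v ≤ x
        · simp only [Set.indicator_of_mem (show x ∈ Set.Ici v from hx)]
          rw [max_eq_left (by linarith), max_eq_left (by linarith)]; linarith
        · simp only [Set.indicator_of_notMem (show x ∉ Set.Ici v from hx)]
          rw [max_eq_right (by linarith)]; simp
      rw [integral_add ((integrable_const _).indicator measurableSet_Ici) (integrable_posPart h v),
        integral_indicator_const _ measurableSet_Ici, smul_eq_mul] at h2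
      nlinarith
    · have h1 : (η : Measure ℝ).real (Set.Ioi v) ≤ 1 - π := by
        rw [← Set.compl_Iic, probReal_compl_eq_one_sub measurableSet_Iic]
        have : π ≤ (η : Measure ℝ).real (Set.Iic v) := le_distFun_VaR hπ0 hπ1 η
        linarith
      have h2 : ∫ x, ((Set.Ioi v).indicator (fun _ => v - z) x + max (x - v) 0) ∂(η : Measure ℝ) ≤
          ∫ x, max (x - z) 0 ∂(η : Measure ℝ) := by
        refine integral_mono (((integrable_const _).indicator measurableSet_Ioi).add
          (integrable_posPart h v)) (integrable_posPart h z) fun x => ?_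
        by_cases hx : v < x
        · simp only [Set.indicator_of_mem (show x ∈ Set.Ioi v from hx)]
          rw [max_eq_left (by linarith : (0 : ℝ) ≤ x - v)]
          exact le_trans (by linarith) (le_max_left _ _)
        · simp only [Set.indicator_of_notMem (show x ∉ Set.Ioi v from hx)]
          rw [max_eq_right (by linarith : x - v ≤ 0)]; simp
      rw [integral_add ((integrable_const _).indicator measurableSet_Ioi) (integrable_posPart h v),
        integral_indicator_const _ measurableSet_Ioi, smul_eq_mul] at h2
      nlinarith
  unfold ruObj
  have : (v - z) + (∫ x, max (x - v) 0 ∂(η : Measure ℝ)) / (1 - π) ≤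
      (∫ x, max (x - z) 0 ∂(η : Measure ℝ)) / (1 - π) := by
    rw [le_div_iff₀ hpos, add_mul, div_mul_cancel₀ _ hpos.ne']
    exact key
  linarith

theorem le_ruObj (hπ1 : π < 1) (z : ℝ) : z ≤ ruObj π η z := by
  have : 0 ≤ (∫ x, max (x - z) 0 ∂(η : Measure ℝ)) / (1 - π) :=
    div_nonneg (integral_nonneg fun x => le_max_right _ _) (by linarith)
  unfold ruObj
  linarith

theorem VaR_le_CVaR (hπ1 : π < 1) (h : Integrable (fun x => x) (η : Measure ℝ)) :
    VaR π η ≤ CVaR π η := by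
  rw [CVaR_eq_ruObj hπ1 h]
  exact le_ruObj hπ1 _

end RockafellarUryasev

/-! ### Weak continuity of CVaR on the moment class -/

section Continuity

variable {ε B π : ℝ} {η : ProbabilityMeasure ℝ}

theorem posPart_le_rpow_div (hε : 0 < ε) {m : ℝ} (hm : 0 < m) (x : ℝ) :
    max (x - m) 0 ≤ |x| ^ (1 + ε) / m ^ ε := by
  have hpow : 0 < m ^ ε := Real.rpow_pos_of_pos hm ε
  refine max_le ?_ (by positivity)
  rcases le_total x m with h | h
  · exact le_trans (by linarith) (show (0 : ℝ) ≤ |x| ^ (1 + ε) / m ^ ε by positivity)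
  · have hx : 0 < x := hm.trans_le h
    rw [le_div_iff₀ hpow, abs_of_pos hx, Real.rpow_add hx, Real.rpow_one]
    have := Real.rpow_le_rpow hm.le h hε.le
    exact mul_le_mul (by linarith) this hpow.le hx.le

/-- The truncations at height `n` are weakly continuous, and their error is a tail integral of order
`B / (z + n)^ε`, uniformly over the class. -/
theorem continuousOn_integral_posPart (hε : 0 < ε) (hB : 0 ≤ B) (z : ℝ) :
    ContinuousOn (fun η : ProbabilityMeasure ℝ => ∫ x, max (x - z) 0 ∂(η : Measure ℝ))
      (momentClass ε B) := by
  let k (n : ℕ) : ℝ →ᵇ ℝ := BoundedContinuousFunction.ofNormedAddCommGroup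
    (fun x => min (max (x - z) 0) (n : ℝ)) (by fun_prop) n (fun x => by
      rw [Real.norm_of_nonneg (by positivity)]
      exact min_le_right _ _)
  have hunif : TendstoUniformlyOn
      (fun (n : ℕ) (η : ProbabilityMeasure ℝ) => ∫ x, k n x ∂(η : Measure ℝ))
      (fun η : ProbabilityMeasure ℝ => ∫ x, max (x - z) 0 ∂(η : Measure ℝ))
      atTop (momentClass ε B) := by
    have hlim : Tendsto (fun n : ℕ => B / (z + n) ^ ε) atTop (𝓝 0) :=
      Tendsto.const_div_atTop ((tendsto_rpow_atTop hε).comp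
        (tendsto_atTop_add_const_left _ _ tendsto_natCast_atTop_atTop)) B
    rw [Metric.tendstoUniformlyOn_iff]
    intro δ hδ
    obtain ⟨N, hN⟩ := exists_nat_gt (-z)
    filter_upwards [hlim.eventually_mem (Iio_mem_nhds hδ), eventually_ge_atTop N] with n hn hnN η hη
    have hm : 0 < z + n := by
      have : (N : ℝ) ≤ n := by exact_mod_cast hnN
      linarith
    have hid := integrable_id_of_mem hε hη
    have heq : ∫ x, max (x - z) 0 ∂(η : Measure ℝ) - ∫ x, k n x ∂(η : Measure ℝ) =
        ∫ x, max (x - (z + n)) 0 ∂(η : Measure ℝ) := by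
      rw [← integral_sub (integrable_posPart hid z) ((k n).integrable _)]
      refine integral_congr_ae (Eventually.of_forall fun x => ?_)
      change max (x - z) 0 - min (max (x - z) 0) (n : ℝ) = max (x - (z + n)) 0
      have : (0 : ℝ) ≤ n := n.cast_nonneg
      grind
    rw [Real.dist_eq, heq, abs_of_nonneg (integral_nonneg fun x => le_max_right _ _)]
    refine lt_of_le_of_lt ?_ hn
    calc ∫ x, max (x - (z + n)) 0 ∂(η : Measure ℝ)
        ≤ ∫ x, |x| ^ (1 + ε) / (z + n) ^ ε ∂(η : Measure ℝ) :=
          integral_mono (integrable_posPart hid _) ((integrable_abs_rpow hε hη).div_const _)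
            (posPart_le_rpow_div hε hm)
      _ = (∫ x, |x| ^ (1 + ε) ∂(η : Measure ℝ)) / (z + n) ^ ε := integral_div _ _
      _ ≤ B / (z + n) ^ ε := by
          gcongr
          exact integral_abs_rpow_le hε hB hη
  exact hunif.continuousOn (Frequently.of_forall fun n =>
    (ProbabilityMeasure.continuous_integral_boundedContinuousFunction (k n)).continuousOn)

theorem continuousOn_ruObj (hε : 0 < ε) (hB : 0 ≤ B) (z : ℝ) :
    ContinuousOn (fun η : ProbabilityMeasure ℝ => ruObj π η z) (momentClass ε B) :=
  continuousOn_const.add ((continuousOn_integral_posPart hε hB z).div_const _)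

theorem ruObj_le_add (hπ1 : π < 1) (h : Integrable (fun x => x) (η : Measure ℝ)) (z w : ℝ) :
    ruObj π η w ≤ ruObj π η z + (1 + 1 / (1 - π)) * |z - w| := by
  have hpos : 0 < 1 - π := by linarith
  have h1 : ∫ x, max (x - w) 0 ∂(η : Measure ℝ) ≤
      ∫ x, max (x - z) 0 ∂(η : Measure ℝ) + |z - w| := by
    have h2 : ∫ x, max (x - w) 0 ∂(η : Measure ℝ) ≤
        ∫ x, (max (x - z) 0 + |z - w|) ∂(η : Measure ℝ) := by
      refine integral_mono (integrable_posPart h w)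
        ((integrable_posPart h z).add (integrable_const _)) fun x => ?_
      have := le_abs_self (z - w)
      have := abs_nonneg (z - w)
      grind
    rwa [integral_add (integrable_posPart h z) (integrable_const _), integral_const,
      probReal_univ, one_smul] at h2
  have h3 := div_le_div_of_nonneg_right h1 hpos.le
  rw [add_div] at h3
  have h4 : (1 + 1 / (1 - π)) * |z - w| = |z - w| + |z - w| / (1 - π) := by ring
  have h5 := neg_abs_le (z - w)
  unfold ruObj
  rw [h4]
  linarith

theorem integral_abs_le (hε : 0 < ε) (hB : 0 ≤ B) (hη : η ∈ momentClass ε B) :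
    ∫ x, |x| ∂(η : Measure ℝ) ≤ 1 + B := by
  have h := integral_mono (integrable_id_of_mem hε hη).abs
    ((integrable_const (1 : ℝ)).add (integrable_abs_rpow hε hη)) (abs_le_one_add_rpow hε)
  refine h.trans ?_
  have := integral_add (integrable_const (1 : ℝ)) (integrable_abs_rpow hε hη)
  simp only [integral_const, probReal_univ, one_smul] at this
  have h2 := integral_abs_rpow_le hε hB hη
  simp only [Pi.add_apply]
  linarith

/-- A bound uniform over the class confines the minimization over thresholds to a fixed compact
interval. -/
theorem abs_VaR_le (hε : 0 < ε) (hB : 0 ≤ B) (hπ0 : 0 < π) (hπ1 : π < 1)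
    (hη : η ∈ momentClass ε B) :
    |VaR π η| ≤ (1 + B) / (1 - π) + 2 * (1 + B) / π := by
  have hpos : 0 < 1 - π := by linarith
  have hid := integrable_id_of_mem hε hη
  have habs := integral_abs_le hε hB hη
  have hc0 : CVaR π η ≤ (1 + B) / (1 - π) := by
    refine (CVaR_le_ruObj hπ0 hπ1 hid 0).trans ?_
    rw [ruObj, zero_add]
    gcongr
    refine le_trans (integral_mono (integrable_posPart hid 0) hid.abs fun x => ?_) habs
    simp [le_abs_self]
  have h1 : (0 : ℝ) ≤ (1 + B) / (1 - π) := by positivity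
  have h2 : (0 : ℝ) ≤ 2 * (1 + B) / π := by positivity
  rw [abs_le]
  constructor
  · have h3 : -(1 + B) - VaR π η ≤ ∫ x, max (x - VaR π η) 0 ∂(η : Measure ℝ) := by
      have h4 : ∫ x, (-|x| - VaR π η) ∂(η : Measure ℝ) ≤
          ∫ x, max (x - VaR π η) 0 ∂(η : Measure ℝ) :=
        integral_mono (hid.abs.neg.sub (integrable_const _)) (integrable_posPart hid _)
          fun x => le_trans (by simpa using neg_abs_le x) (le_max_left _ _)
      have h5 : Integrable (fun x : ℝ => -|x|) (η : Measure ℝ) := hid.abs.neg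
      rw [integral_sub h5 (integrable_const _), integral_neg, integral_const,
        probReal_univ, one_smul] at h4
      linarith
    rw [CVaR_eq_ruObj hπ1 hid, ruObj] at hc0
    have h6 := div_le_div_of_nonneg_right h3 hpos.le
    have h7 : VaR π η + (-(1 + B) - VaR π η) / (1 - π) ≤ (1 + B) / (1 - π) := by linarith
    -- After clearing the denominator the coefficient of the value-at-risk is `-π`, whence the term
    -- `2 (1 + B) / π`.
    have h8 : VaR π η * (1 - π) + (-(1 + B) - VaR π η) ≤ 1 + B := by
      rwa [le_div_iff₀ hpos, add_mul, div_mul_cancel₀ _ hpos.ne'] at h7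
    have h9 : -(2 * (1 + B) / π) ≤ VaR π η := by
      rw [neg_le, ← neg_le, ← neg_div, div_le_iff₀ hπ0]
      linarith
    linarith
  · linarith [VaR_le_CVaR hπ1 hid]

/-- CVaR is a minimum of functions continuous in `η`. Upper semicontinuity uses one fixed threshold;
lower semicontinuity uses compactness of the threshold interval and a Lipschitz constant in `z`
independent of `η`. -/
theorem continuousOn_CVaR (hε : 0 < ε) (hB : 0 ≤ B) (hπ0 : 0 < π) (hπ1 : π < 1) :
    ContinuousOn (CVaR π) (momentClass ε B) := by
  intro η hη
  have hid := integrable_id_of_mem hε hη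
  refine tendsto_order.2 ⟨fun a ha => ?_, fun a ha => ?_⟩
  · set R := (1 + B) / (1 - π) + 2 * (1 + B) / π with hR
    have hL : 0 < 1 + 1 / (1 - π) := by
      have : 0 < 1 - π := by linarith
      positivity
    have key : ∀ᶠ η' in 𝓝 η, ∀ z ∈ Set.Icc (-R) R, η' ∈ momentClass ε B → a < ruObj π η' z := by
      refine isCompact_Icc.eventually_forall_of_forall_eventually fun z _ => ?_
      have hz : (a + CVaR π η) / 2 < ruObj π η z := by
        linarith [CVaR_le_ruObj hπ0 hπ1 hid z]
      have h1 := eventually_nhdsWithin_iff.1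
        ((continuousOn_ruObj (π := π) hε hB z η hη).eventually_mem (Ioi_mem_nhds hz))
      have h2 : ∀ᶠ w in 𝓝 z, (1 + 1 / (1 - π)) * |w - z| < (CVaR π η - a) / 2 := by
        have hc : Continuous fun w : ℝ => (1 + 1 / (1 - π)) * |w - z| := by fun_prop
        refine hc.continuousAt.eventually_mem (Iio_mem_nhds ?_)
        simp only [sub_self, abs_zero, mul_zero]
        linarith
      rw [nhds_prod_eq]
      filter_upwards [h1.prod_mk h2] with p hp hpL
      have h3 := hp.1 hpL
      have h4 := ruObj_le_add hπ1 (integrable_id_of_mem hε hpL) p.2 z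
      have h5 : (a + CVaR π η) / 2 < ruObj π p.1 z := h3
      linarith [hp.2]
    refine eventually_nhdsWithin_iff.2 (key.mono fun η' h hη' => ?_)
    rw [CVaR_eq_ruObj hπ1 (integrable_id_of_mem hε hη')]
    exact h _ (abs_le.1 (abs_VaR_le hε hB hπ0 hπ1 hη')) hη'
  · rw [CVaR_eq_ruObj hπ1 hid] at ha
    filter_upwards [(continuousOn_ruObj (π := π) hε hB (VaR π η) η hη).eventually_mem
      (Iio_mem_nhds ha), self_mem_nhdsWithin] with η' h hη'
    exact (CVaR_le_ruObj hπ0 hπ1 (integrable_id_of_mem hε hη') _).trans_lt h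

end Continuity

/-! ### Mixtures, used to create slack -/

section Mixture

/-- The mixture `(1 - s) κ + s κ₀`. -/
def mix (s : unitInterval) (κ κ₀ : ProbabilityMeasure ℝ) : ProbabilityMeasure ℝ :=
  ⟨ENNReal.ofReal (1 - s) • (κ : Measure ℝ) + ENNReal.ofReal s • (κ₀ : Measure ℝ), ⟨by
    simp only [Measure.coe_add, Measure.coe_smul, Pi.add_apply, Pi.smul_apply, measure_univ,
      smul_eq_mul, mul_one]
    rw [← ENNReal.ofReal_add (by linarith [s.2.2]) s.2.1]
    simp⟩⟩

variable {ε B π : ℝ} {s : unitInterval} {κ κ₀ : ProbabilityMeasure ℝ} {f : ℝ → ℝ}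

theorem coe_mix : (mix s κ κ₀ : Measure ℝ) =
    ENNReal.ofReal (1 - s) • (κ : Measure ℝ) + ENNReal.ofReal s • (κ₀ : Measure ℝ) := rfl

theorem integrable_mix (h : Integrable f (κ : Measure ℝ)) (h₀ : Integrable f (κ₀ : Measure ℝ)) :
    Integrable f (mix s κ κ₀ : Measure ℝ) :=
  (h.smul_measure ENNReal.ofReal_ne_top).add_measure (h₀.smul_measure ENNReal.ofReal_ne_top)

theorem integral_mix (h : Integrable f (κ : Measure ℝ)) (h₀ : Integrable f (κ₀ : Measure ℝ)) :
    ∫ x, f x ∂(mix s κ κ₀ : Measure ℝ) =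
      (1 - s) * ∫ x, f x ∂(κ : Measure ℝ) + s * ∫ x, f x ∂(κ₀ : Measure ℝ) := by
  rw [coe_mix, integral_add_measure (h.smul_measure ENNReal.ofReal_ne_top)
    (h₀.smul_measure ENNReal.ofReal_ne_top), integral_smul_measure, integral_smul_measure,
    ENNReal.toReal_ofReal (by linarith [s.2.2]), ENNReal.toReal_ofReal s.2.1]
  rfl

theorem ruObj_mix (h : Integrable (fun x => x) (κ : Measure ℝ))
    (h₀ : Integrable (fun x => x) (κ₀ : Measure ℝ)) (z : ℝ) :
    ruObj π (mix s κ κ₀) z = (1 - s) * ruObj π κ z + s * ruObj π κ₀ z := by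
  unfold ruObj
  rw [integral_mix (integrable_posPart h z) (integrable_posPart h₀ z)]
  ring

/-- For a fixed threshold the Rockafellar-Uryasev objective is affine in the measure, so its minimum
is concave. -/
theorem le_CVaR_mix (hπ0 : 0 < π) (hπ1 : π < 1) (h : Integrable (fun x => x) (κ : Measure ℝ))
    (h₀ : Integrable (fun x => x) (κ₀ : Measure ℝ)) :
    (1 - s) * CVaR π κ + s * CVaR π κ₀ ≤ CVaR π (mix s κ κ₀) := by
  rw [CVaR_eq_ruObj hπ1 (integrable_mix (s := s) h h₀), ruObj_mix h h₀]
  have h1 := CVaR_le_ruObj hπ0 hπ1 h (VaR π (mix s κ κ₀))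
  have h2 := CVaR_le_ruObj hπ0 hπ1 h₀ (VaR π (mix s κ κ₀))
  have := s.2.1
  have := s.2.2
  gcongr

theorem klDiv_mix_le (η : ProbabilityMeasure ℝ) (hs : (s : ℝ) < 1)
    (hfin : klDiv (η : Measure ℝ) (κ : Measure ℝ) ≠ ∞) :
    klDiv (η : Measure ℝ) (mix s κ κ₀ : Measure ℝ) ≤
      ENNReal.ofReal ((klDiv (η : Measure ℝ) (κ : Measure ℝ)).toReal - Real.log (1 - s)) :=
  klDiv_le_sub_log (by linarith) (by rw [coe_mix]; exact Measure.le_add_right le_rfl) hfin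

/-- The cost `-log (1 - s)` of mixing tends to `0` with `s`, so a strict divergence bound survives
some positive weight. -/
theorem exists_klDiv_mix_lt {η : ProbabilityMeasure ℝ} {v : ℝ≥0∞}
    (h : klDiv (η : Measure ℝ) (κ : Measure ℝ) < v) (κ₀ : ProbabilityMeasure ℝ) :
    ∃ s : unitInterval, 0 < (s : ℝ) ∧ (s : ℝ) < 1 ∧
      klDiv (η : Measure ℝ) (mix s κ κ₀ : Measure ℝ) < v := by
  set k := (klDiv (η : Measure ℝ) (κ : Measure ℝ)).toReal with hk
  have hlim : Tendsto (fun s : ℝ => ENNReal.ofReal (k - Real.log (1 - s))) (𝓝 0)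
      (𝓝 (klDiv (η : Measure ℝ) (κ : Measure ℝ))) := by
    have hc : ContinuousAt (fun s : ℝ => ENNReal.ofReal (k - Real.log (1 - s))) 0 := by
      refine ENNReal.continuous_ofReal.continuousAt.comp (continuousAt_const.sub
        ((continuousAt_const.sub continuousAt_id).log (by simp)))
    have := hc.tendsto
    simpa [hk, ENNReal.ofReal_toReal h.ne_top] using this
  have h1 := (hlim.mono_left (nhdsWithin_le_nhds (s := Set.Ioi 0))).eventually_mem (Iio_mem_nhds h)
  obtain ⟨s, hsv, hs⟩ := (h1.and (Ioo_mem_nhdsGT (zero_lt_one' ℝ))).exists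
  exact ⟨⟨s, hs.1.le, hs.2.le⟩, hs.1, hs.2, (klDiv_mix_le η hs.2 h.ne_top).trans_lt hsv⟩

theorem integral_abs_rpow_mix_lt (hε : 0 < ε) (hB : 0 ≤ B) (hs : 0 < (s : ℝ))
    (hκ : κ ∈ momentClass ε B) (hκ₀ : κ₀ ∈ momentClass ε B)
    (h₀ : ∫ x, |x| ^ (1 + ε) ∂(κ₀ : Measure ℝ) < B) :
    ∫ x, |x| ^ (1 + ε) ∂(mix s κ κ₀ : Measure ℝ) < B := by
  rw [integral_mix (integrable_abs_rpow hε hκ) (integrable_abs_rpow hε hκ₀)]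
  have h1 := mul_le_mul_of_nonneg_left (integral_abs_rpow_le hε hB hκ)
    (show 0 ≤ 1 - (s : ℝ) by linarith [s.2.2])
  have h2 := mul_lt_mul_of_pos_left h₀ hs
  linarith

theorem mix_mem_momentClass (hε : 0 < ε) (hB : 0 ≤ B)
    (hκ : κ ∈ momentClass ε B) (hκ₀ : κ₀ ∈ momentClass ε B) : mix s κ κ₀ ∈ momentClass ε B := by
  refine mem_momentClass_of_integral_le
    (integrable_mix (integrable_abs_rpow hε hκ) (integrable_abs_rpow hε hκ₀)) ?_
  rw [integral_mix (integrable_abs_rpow hε hκ) (integrable_abs_rpow hε hκ₀)]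
  have h1 := mul_le_mul_of_nonneg_left (integral_abs_rpow_le hε hB hκ)
    (show 0 ≤ 1 - (s : ℝ) by linarith [s.2.2])
  have h2 := mul_le_mul_of_nonneg_left (integral_abs_rpow_le hε hB hκ₀) s.2.1
  linarith

end Mixture

/-! ### Transporting a density to nearby measures -/

section Tilt

variable {ε B : ℝ} {h : ℝ →ᵇ ℝ} {σ : FiniteMeasure ℝ} {η : ProbabilityMeasure ℝ} {δ : ℝ}

/-- The finite measure `h • η + σ`. -/
def tilt (h : ℝ →ᵇ ℝ) (σ : FiniteMeasure ℝ) (η : ProbabilityMeasure ℝ) : FiniteMeasure ℝ :=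
  ⟨(η : Measure ℝ).withDensity (fun x => ENNReal.ofReal (h x)) + (σ : Measure ℝ), by
    have := isFiniteMeasure_withDensity_ofReal (h.integrable (η : Measure ℝ)).2
    infer_instance⟩

theorem coe_tilt : (tilt h σ η : Measure ℝ) =
    (η : Measure ℝ).withDensity (fun x => ENNReal.ofReal (h x)) + (σ : Measure ℝ) := rfl

theorem integrable_withDensity_boundedContinuous (hh : ∀ x, 0 ≤ h x) {f : ℝ → ℝ} :
    Integrable f ((η : Measure ℝ).withDensity fun x => ENNReal.ofReal (h x)) ↔
      Integrable (fun x => h x * f x) (η : Measure ℝ) := by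
  rw [integrable_withDensity_iff_integrable_smul' h.continuous.measurable.ennreal_ofReal (by simp)]
  simp [ENNReal.toReal_ofReal (hh _)]

theorem integrable_tilt (hh : ∀ x, 0 ≤ h x) {f : ℝ → ℝ}
    (hf : Integrable (fun x => h x * f x) (η : Measure ℝ)) (hσ : Integrable f (σ : Measure ℝ)) :
    Integrable f (tilt h σ η : Measure ℝ) :=
  ((integrable_withDensity_boundedContinuous hh).2 hf).add_measure hσ

theorem integral_tilt (hh : ∀ x, 0 ≤ h x) {f : ℝ → ℝ}
    (hf : Integrable (fun x => h x * f x) (η : Measure ℝ)) (hσ : Integrable f (σ : Measure ℝ)) :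
    ∫ x, f x ∂(tilt h σ η : Measure ℝ) =
      ∫ x, h x * f x ∂(η : Measure ℝ) + ∫ x, f x ∂(σ : Measure ℝ) := by
  rw [coe_tilt, integral_add_measure ((integrable_withDensity_boundedContinuous hh).2 hf) hσ,
    integral_withDensity_eq_integral_toReal_smul h.continuous.measurable.ennreal_ofReal (by simp)]
  simp [ENNReal.toReal_ofReal (hh _)]

theorem integral_tilt_boundedContinuous (hh : ∀ x, 0 ≤ h x) (f : ℝ →ᵇ ℝ) :
    ∫ x, f x ∂(tilt h σ η : Measure ℝ) =
      ∫ x, (h * f) x ∂(η : Measure ℝ) + ∫ x, f x ∂(σ : Measure ℝ) :=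
  integral_tilt hh ((h * f).integrable _) (f.integrable _)

theorem coe_mass_eq_integral (μ : FiniteMeasure ℝ) :
    (μ.mass : ℝ) = ∫ _, (1 : ℝ) ∂(μ : Measure ℝ) := by
  rw [integral_const, smul_eq_mul, mul_one]
  rfl

theorem mass_tilt (hh : ∀ x, 0 ≤ h x) :
    ((tilt h σ η).mass : ℝ) = ∫ x, h x ∂(η : Measure ℝ) + σ.mass := by
  have := integral_tilt_boundedContinuous (η := η) (σ := σ) hh (BoundedContinuousFunction.const ℝ 1)
  have e : h * BoundedContinuousFunction.const ℝ 1 = h := by ext; simp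
  rw [e] at this
  rw [coe_mass_eq_integral, coe_mass_eq_integral]
  exact this

theorem continuous_tilt (hh : ∀ x, 0 ≤ h x) : Continuous (tilt h σ) := by
  rw [FiniteMeasure.continuous_iff_forall_continuous_integral]
  intro f
  simp_rw [integral_tilt_boundedContinuous hh]
  exact (ProbabilityMeasure.continuous_integral_boundedContinuousFunction (h * f)).add
    continuous_const

theorem mass_tilt_pos (hδ : 0 < δ) (hh : ∀ x, δ ≤ h x) : 0 < ((tilt h σ η).mass : ℝ) := by
  rw [mass_tilt fun x => hδ.le.trans (hh x)]
  have h1 : ∫ _, δ ∂(η : Measure ℝ) ≤ ∫ x, h x ∂(η : Measure ℝ) :=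
    integral_mono (integrable_const _) (h.integrable _) hh
  simp only [integral_const, probReal_univ, one_smul] at h1
  have : (0 : ℝ) ≤ σ.mass := NNReal.coe_nonneg _
  linarith

theorem tilt_ne_zero (hδ : 0 < δ) (hh : ∀ x, δ ≤ h x) : tilt h σ η ≠ 0 := by
  rw [← FiniteMeasure.mass_nonzero_iff]
  exact_mod_cast (mass_tilt_pos (σ := σ) (η := η) hδ hh).ne'

theorem coe_normalize_tilt (hδ : 0 < δ) (hh : ∀ x, δ ≤ h x) :
    ((tilt h σ η).normalize : Measure ℝ) =
      ENNReal.ofReal ((tilt h σ η).mass : ℝ)⁻¹ • (tilt h σ η : Measure ℝ) := by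
  rw [FiniteMeasure.toMeasure_normalize_eq_of_nonzero _ (tilt_ne_zero hδ hh), ← NNReal.coe_inv,
    ENNReal.ofReal_coe_nnreal]
  rfl

theorem integrable_log_boundedContinuous (hδ : 0 < δ) (hh : ∀ x, δ ≤ h x) (μ : Measure ℝ)
    [IsFiniteMeasure μ] : Integrable (fun x => Real.log (h x)) μ := by
  refine Integrable.of_bound
    (Real.measurable_log.comp h.continuous.measurable).aestronglyMeasurable
    (max |Real.log δ| |Real.log ‖h‖|) (Eventually.of_forall fun x => ?_)
  exact abs_le_max_abs_abs (Real.log_le_log hδ (hh x))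
    (Real.log_le_log (hδ.trans_le (hh x)) ((le_abs_self _).trans (h.norm_coe_le_norm x)))

/-- The normalized measure dominates `(h / m) η`, where `m` is the mass. The bound involves only
integrals of bounded continuous functions of `η`, hence is weakly continuous. -/
theorem klDiv_normalize_tilt_le (hδ : 0 < δ) (hh : ∀ x, δ ≤ h x) :
    klDiv (η : Measure ℝ) ((tilt h σ η).normalize : Measure ℝ) ≤
      ENNReal.ofReal (-∫ x, Real.log (h x) ∂(η : Measure ℝ) +
        Real.log ((tilt h σ η).mass : ℝ)) := by
  set m : ℝ := ((tilt h σ η).mass : ℝ) with hm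
  have hmpos : 0 < m := mass_tilt_pos hδ hh
  have hle : (η : Measure ℝ).withDensity (fun x => ENNReal.ofReal ((m⁻¹ • h) x)) ≤
      ((tilt h σ η).normalize : Measure ℝ) := by
    rw [coe_normalize_tilt hδ hh, ← hm]
    have : (fun x => ENNReal.ofReal ((m⁻¹ • h) x)) =
        ENNReal.ofReal m⁻¹ • fun x => ENNReal.ofReal (h x) := by
      ext x
      simp [ENNReal.ofReal_mul (inv_pos.2 hmpos).le]
    rw [this, withDensity_smul _ h.continuous.measurable.ennreal_ofReal, coe_tilt]
    gcongr
    exact Measure.le_add_right le_rfl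
  refine (klDiv_le_neg_integral_log (δ := m⁻¹ * δ) (by positivity) (fun x => ?_) hle).trans
    (le_of_eq ?_)
  · exact mul_le_mul_of_nonneg_left (hh x) (inv_pos.2 hmpos).le
  · congr 1
    have hpos (x : ℝ) : 0 < h x := hδ.trans_le (hh x)
    have h1 (x : ℝ) : Real.log ((m⁻¹ • h) x) = Real.log (h x) - Real.log m := by
      change Real.log (m⁻¹ * h x) = _
      rw [Real.log_mul (inv_pos.2 hmpos).ne' (hpos x).ne', Real.log_inv]
      ring
    simp_rw [h1]
    rw [integral_sub (integrable_log_boundedContinuous hδ hh _) (integrable_const _)]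
    simp
    ring

theorem continuous_integral_log (hδ : 0 < δ) (hh : ∀ x, δ ≤ h x) :
    Continuous fun η : ProbabilityMeasure ℝ => ∫ x, Real.log (h x) ∂(η : Measure ℝ) := by
  let k : ℝ →ᵇ ℝ := BoundedContinuousFunction.ofNormedAddCommGroup (fun x => Real.log (h x))
    (h.continuous.log fun x => (hδ.trans_le (hh x)).ne') (max |Real.log δ| |Real.log ‖h‖|)
    fun x => abs_le_max_abs_abs (Real.log_le_log hδ (hh x))
      (Real.log_le_log (hδ.trans_le (hh x)) ((le_abs_self _).trans (h.norm_coe_le_norm x)))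
  exact ProbabilityMeasure.continuous_integral_boundedContinuousFunction k

theorem continuous_mass_tilt (hh : ∀ x, 0 ≤ h x) :
    Continuous fun η : ProbabilityMeasure ℝ => ((tilt h σ η).mass : ℝ) := by
  simp_rw [mass_tilt hh]
  exact (ProbabilityMeasure.continuous_integral_boundedContinuousFunction h).add continuous_const

/-- If a normalized tilt of `η` by a continuous density meets strict moment and divergence bounds,
so do the tilts of the measures near `η`. -/
theorem eventually_exists_normalize_tilt (hε : 0 < ε) (hB : 0 ≤ B) {k : ℝ →ᵇ ℝ}
    (hk : HasCompactSupport k) (hk0 : ∀ x, 0 ≤ k x) (hδ : 0 < δ)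
    (hkh : ∀ x, h x = k x + δ)
    (hσ : Integrable (fun x => |x| ^ (1 + ε)) (σ : Measure ℝ))
    {N : Set (ProbabilityMeasure ℝ)} (hN : N ∈ 𝓝 (tilt h σ η).normalize) {v : ℝ} (hv0 : 0 < v)
    (hv : -∫ x, Real.log (h x) ∂(η : Measure ℝ) + Real.log ((tilt h σ η).mass : ℝ) < v)
    (hmom : ∫ x, k x * |x| ^ (1 + ε) ∂(η : Measure ℝ) + ∫ x, |x| ^ (1 + ε) ∂(σ : Measure ℝ) + δ * B
      < B * (tilt h σ η).mass) :
    ∀ᶠ η' : ProbabilityMeasure ℝ in 𝓝[momentClass ε B] η, ∃ κ' ∈ momentClass ε B, κ' ∈ N ∧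
      klDiv (η' : Measure ℝ) (κ' : Measure ℝ) < ENNReal.ofReal v := by
  have hh (x : ℝ) : δ ≤ h x := by linarith [hk0 x, hkh x]
  have hh0 (x : ℝ) : 0 ≤ h x := hδ.le.trans (hh x)
  -- Compact support makes `k |x|^(1+ε)` bounded, so its integral is weakly continuous. The
  -- remaining part `δ |x|^(1+ε)` is at most `δ B` in mean for every measure in the class.
  have hkp_cont : Continuous fun x => k x * |x| ^ (1 + ε) := k.continuous.mul (continuous_abs_rpow hε)
  obtain ⟨C, hC⟩ := (hk.mul_right (f' := fun x => |x| ^ (1 + ε))).exists_bound_of_continuous hkp_cont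
  let kp : ℝ →ᵇ ℝ := BoundedContinuousFunction.ofNormedAddCommGroup
    (fun x => k x * |x| ^ (1 + ε)) hkp_cont C hC
  have h1 : ∀ᶠ η' in 𝓝 η, (tilt h σ η').normalize ∈ N :=
    (FiniteMeasure.tendsto_normalize_of_tendsto ((continuous_tilt hh0).tendsto η)
      (tilt_ne_zero hδ hh)).eventually_mem hN
  have h2 : ∀ᶠ η' : ProbabilityMeasure ℝ in 𝓝 η, -∫ x, Real.log (h x) ∂(η' : Measure ℝ) +
      Real.log ((tilt h σ η').mass : ℝ) < v := by
    have hc : Continuous fun η' : ProbabilityMeasure ℝ =>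
        -∫ x, Real.log (h x) ∂(η' : Measure ℝ) + Real.log ((tilt h σ η').mass : ℝ) :=
      (continuous_integral_log hδ hh).neg.add
        ((continuous_mass_tilt hh0).log fun η' => (mass_tilt_pos hδ hh).ne')
    exact hc.continuousAt.eventually_mem (Iio_mem_nhds hv)
  have h3 : ∀ᶠ η' : ProbabilityMeasure ℝ in 𝓝 η, ∫ x, k x * |x| ^ (1 + ε) ∂(η' : Measure ℝ) +
      ∫ x, |x| ^ (1 + ε) ∂(σ : Measure ℝ) + δ * B < B * (tilt h σ η').mass := by
    have hc : Continuous fun η' : ProbabilityMeasure ℝ =>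
        ∫ x, k x * |x| ^ (1 + ε) ∂(η' : Measure ℝ) :=
      ProbabilityMeasure.continuous_integral_boundedContinuousFunction kp
    exact ((hc.add continuous_const).add continuous_const).continuousAt.eventually_lt
      ((continuous_mass_tilt hh0).const_mul B).continuousAt hmom
  refine eventually_nhdsWithin_iff.2 ?_
  filter_upwards [h1, h2, h3] with η' h1 h2 h3 hη'
  refine ⟨(tilt h σ η').normalize, ?_, h1, (klDiv_normalize_tilt_le hδ hh).trans_lt ?_⟩
  · have hmpos := mass_tilt_pos (σ := σ) (η := η') hδ hh
    have hkpi : Integrable (fun x => k x * |x| ^ (1 + ε)) (η' : Measure ℝ) := kp.integrable _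
    have hint' : Integrable (fun x => δ * |x| ^ (1 + ε)) (η' : Measure ℝ) :=
      (integrable_abs_rpow hε hη').const_mul δ
    have heq : (fun x => h x * |x| ^ (1 + ε)) =
        fun x => k x * |x| ^ (1 + ε) + δ * |x| ^ (1 + ε) := by
      ext x; rw [hkh]; ring
    have hint : Integrable (fun x => h x * |x| ^ (1 + ε)) (η' : Measure ℝ) := by
      rw [heq]
      exact hkpi.add hint'
    have hI := integrable_tilt hh0 hint hσ
    refine mem_momentClass_of_integral_le ?_ ?_
    · rw [coe_normalize_tilt hδ hh]
      exact hI.smul_measure ENNReal.ofReal_ne_top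
    · rw [coe_normalize_tilt hδ hh, integral_smul_measure, integral_tilt hh0 hint hσ, heq,
        integral_add hkpi hint', integral_const_mul, ENNReal.toReal_ofReal (inv_pos.2 hmpos).le,
        smul_eq_mul, inv_mul_le_iff₀ hmpos]
      have := mul_le_mul_of_nonneg_left (integral_abs_rpow_le hε hB hη') hδ.le
      linarith
  · exact (ENNReal.ofReal_lt_ofReal_iff hv0).2 h2

end Tilt

/-! ### Approximating an arbitrary alternative by tilts -/

section Approximation

variable {ε B : ℝ} {η κ : ProbabilityMeasure ℝ}

theorem integrable_rnDeriv_mul_and_singularPart {f : ℝ → ℝ} (hf : Integrable f (κ : Measure ℝ)) :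
    Integrable (fun x => ((κ : Measure ℝ).rnDeriv η x).toReal * f x) (η : Measure ℝ) ∧
      Integrable f ((κ : Measure ℝ).singularPart η) := by
  rw [Measure.haveLebesgueDecomposition_add (κ : Measure ℝ) (η : Measure ℝ)] at hf
  refine ⟨?_, hf.left_of_add_measure⟩
  exact (integrable_withDensity_iff_integrable_smul' (Measure.measurable_rnDeriv _ _)
    (Measure.rnDeriv_lt_top _ _)).1 hf.right_of_add_measure

theorem integral_eq_rnDeriv_add_singularPart {f : ℝ → ℝ} (hf : Integrable f (κ : Measure ℝ)) :
    ∫ x, f x ∂(κ : Measure ℝ) =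
      ∫ x, ((κ : Measure ℝ).rnDeriv η x).toReal * f x ∂(η : Measure ℝ) +
        ∫ x, f x ∂(κ : Measure ℝ).singularPart η := by
  have hf' := hf
  rw [Measure.haveLebesgueDecomposition_add (κ : Measure ℝ) (η : Measure ℝ)] at hf'
  conv_lhs => rw [Measure.haveLebesgueDecomposition_add (κ : Measure ℝ) (η : Measure ℝ)]
  rw [integral_add_measure hf'.left_of_add_measure hf'.right_of_add_measure, add_comm,
    integral_withDensity_eq_integral_toReal_smul (Measure.measurable_rnDeriv _ _)
      (Measure.rnDeriv_lt_top _ _)]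
  rfl

/-- Continuous functions of compact support are dense in a weighted `L¹` space. -/
theorem exists_boundedContinuous_weighted_approx {w ρ : ℝ → ℝ} (hw : Measurable w)
    (hw1 : ∀ x, 1 ≤ w x) (hwi : Integrable w (η : Measure ℝ)) (hρ0 : ∀ x, 0 ≤ ρ x)
    (hρ : Integrable (fun x => w x * ρ x) (η : Measure ℝ)) {γ : ℝ} (hγ : 0 < γ) :
    ∃ k : ℝ →ᵇ ℝ, HasCompactSupport k ∧ (∀ x, 0 ≤ k x) ∧
      Integrable (fun x => w x * |ρ x - k x|) (η : Measure ℝ) ∧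
      ∫ x, w x * |ρ x - k x| ∂(η : Measure ℝ) ≤ γ := by
  have hw0 (x : ℝ) : 0 ≤ w x := zero_le_one.trans (hw1 x)
  -- Weighted approximation is plain `L¹` approximation for the finite measure `w η`. Taking the
  -- positive part afterwards cannot increase the error, as `ρ ≥ 0`.
  set μ := (η : Measure ℝ).withDensity fun x => ENNReal.ofReal (w x) with hμ
  have : IsFiniteMeasure μ := isFiniteMeasure_withDensity_ofReal hwi.2
  have hiff (f : ℝ → ℝ) : Integrable f μ ↔ Integrable (fun x => w x * f x) (η : Measure ℝ) := by
    rw [hμ, integrable_withDensity_iff_integrable_smul' hw.ennreal_ofReal (by simp)]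
    simp only [ENNReal.toReal_ofReal (hw0 _), smul_eq_mul]
  have hint (f : ℝ → ℝ) : ∫ x, f x ∂μ = ∫ x, w x * f x ∂(η : Measure ℝ) := by
    rw [hμ, integral_withDensity_eq_integral_toReal_smul hw.ennreal_ofReal (by simp)]
    simp only [ENNReal.toReal_ofReal (hw0 _), smul_eq_mul]
  have hρμ : Integrable ρ μ := (hiff ρ).2 hρ
  obtain ⟨g, hgs, hg, hgc, hgi⟩ := hρμ.exists_hasCompactSupport_integral_sub_le hγ
  obtain ⟨C, hC⟩ := hgs.exists_bound_of_continuous hgc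
  let k : ℝ →ᵇ ℝ := BoundedContinuousFunction.ofNormedAddCommGroup (fun x => max (g x) 0)
    (by fun_prop) C fun x => by
      rw [Real.norm_of_nonneg (le_max_right _ _)]
      exact max_le ((le_abs_self _).trans (hC x)) ((norm_nonneg _).trans (hC x))
  have hk (x : ℝ) : k x = max (g x) 0 := rfl
  have hle (x : ℝ) : |ρ x - k x| ≤ |ρ x - g x| := by
    have := hρ0 x
    rw [hk]
    grind
  have hki : Integrable (fun x => |ρ x - k x|) μ := (hρμ.sub (k.integrable μ)).abs
  refine ⟨k, ?_, fun x => le_max_right _ _, (hiff _).1 hki, ?_⟩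
  · exact hgs.comp_left (g := fun y => max y 0) (by simp)
  · rw [← hint]
    exact (integral_mono hki (hρμ.sub hgi).abs hle).trans hg

/-- Finite divergence makes `ρ` positive `η`-a.e., with `KL(η, κ) = -∫ log ρ dη`. Then `log ρ - log
h ≤ ρ / h - 1`, and `h ≥ δ` makes this at most `|ρ - k| / δ`. No lower bound on `ρ` is needed. -/
theorem neg_integral_log_le {k h : ℝ →ᵇ ℝ} {δ : ℝ} (hδ : 0 < δ) (hk0 : ∀ x, 0 ≤ k x)
    (hkh : ∀ x, h x = k x + δ) (hfin : klDiv (η : Measure ℝ) (κ : Measure ℝ) ≠ ∞)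
    (hi : Integrable (fun x => |((κ : Measure ℝ).rnDeriv η x).toReal - k x|) (η : Measure ℝ)) :
    -∫ x, Real.log (h x) ∂(η : Measure ℝ) ≤ (klDiv (η : Measure ℝ) (κ : Measure ℝ)).toReal +
      (∫ x, |((κ : Measure ℝ).rnDeriv η x).toReal - k x| ∂(η : Measure ℝ)) / δ := by
  obtain ⟨hac, hllr⟩ := klDiv_ne_top_iff.1 hfin
  have hh (x : ℝ) : δ ≤ h x := by linarith [hk0 x, hkh x]
  have hlog := integrable_log_boundedContinuous hδ hh (η : Measure ℝ)
  rw [toReal_klDiv_of_measure_eq hac (by simp), ← integral_neg, ← integral_div,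
    ← integral_add hllr (hi.div_const δ)]
  refine integral_mono_ae hlog.neg (hllr.add (hi.div_const δ)) ?_
  filter_upwards [neg_llr hac, Measure.rnDeriv_pos' hac,
    Measure.rnDeriv_lt_top (κ : Measure ℝ) (η : Measure ℝ)] with x hx hpos hlt
  set ρ := ((κ : Measure ℝ).rnDeriv η x).toReal with hρ
  have hρpos : 0 < ρ := ENNReal.toReal_pos hpos.ne' hlt.ne
  have hhpos : 0 < h x := hδ.trans_le (hh x)
  have h1 : llr (η : Measure ℝ) κ x = -Real.log ρ := by
    have : -llr (η : Measure ℝ) κ x = Real.log ρ := hx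
    linarith
  have h2 := Real.log_le_sub_one_of_pos (div_pos hρpos hhpos)
  rw [Real.log_div hρpos.ne' hhpos.ne'] at h2
  have h3 : ρ / h x - 1 ≤ |ρ - k x| / δ := by
    have : ρ / h x - 1 = (ρ - h x) / h x := by field_simp
    rw [this]
    calc (ρ - h x) / h x ≤ |ρ - k x| / h x := by
          gcongr
          have := le_abs_self (ρ - k x)
          linarith [hkh x]
      _ ≤ |ρ - k x| / δ := by
          gcongr
          exact hh x
  rw [h1]
  linarith

/-- Lower hemicontinuity of `η ↦ {κ ∈ 𝓛 | KL(η, κ) < v}` at measures `κ` with slack in the moment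
constraint. -/
theorem eventually_exists_klDiv_lt (hε : 0 < ε) (hB : 0 ≤ B) (hη : η ∈ momentClass ε B)
    (hκ : κ ∈ momentClass ε B) (hκB : ∫ x, |x| ^ (1 + ε) ∂(κ : Measure ℝ) < B) {v : ℝ≥0∞}
    (hv : klDiv (η : Measure ℝ) (κ : Measure ℝ) < v) {N : Set (ProbabilityMeasure ℝ)}
    (hN : N ∈ 𝓝 κ) :
    ∀ᶠ η' : ProbabilityMeasure ℝ in 𝓝[momentClass ε B] η, ∃ κ' ∈ momentClass ε B, κ' ∈ N ∧
      klDiv (η' : Measure ℝ) (κ' : Measure ℝ) < v := by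
  obtain ⟨v', hv'0, hvv', hv'v⟩ := ENNReal.lt_iff_exists_real_btwn.1 hv
  have hKv := (ENNReal.lt_ofReal_iff_toReal_lt hv.ne_top).1 hvv'
  set ρ : ℝ → ℝ := fun x => ((κ : Measure ℝ).rnDeriv η x).toReal with hρ
  let σ : FiniteMeasure ℝ := ⟨(κ : Measure ℝ).singularPart η, inferInstance⟩
  have hσ : (σ : Measure ℝ) = (κ : Measure ℝ).singularPart η := rfl
  -- Closeness in this weight controls the errors in mass and in moment at once.
  set w : ℝ → ℝ := fun x => 1 + |x| ^ (1 + ε) with hw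
  have hwm : Measurable w := (continuous_const.add (continuous_abs_rpow hε)).measurable
  have hw1 (x : ℝ) : 1 ≤ w x := by
    have : 0 ≤ |x| ^ (1 + ε) := by positivity
    simp only [hw]; linarith
  have hpη := integrable_abs_rpow hε hη
  have hpκ := integrable_abs_rpow hε hκ
  have hwi : Integrable w (η : Measure ℝ) := (integrable_const _).add hpη
  have hwκ : Integrable w (κ : Measure ℝ) := (integrable_const _).add hpκ
  have hρw : Integrable (fun x => w x * ρ x) (η : Measure ℝ) := by
    simpa [mul_comm] using (integrable_rnDeriv_mul_and_singularPart (η := η) hwκ).1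
  have hρi : Integrable ρ (η : Measure ℝ) := Measure.integrable_toReal_rnDeriv
  set δ : ℕ → ℝ := fun n => 1 / ((n : ℝ) + 1) with hδ
  have hδpos (n : ℕ) : 0 < δ n := by simp only [hδ]; positivity
  have hδ0 : Tendsto δ atTop (𝓝 0) := tendsto_one_div_add_atTop_nhds_zero_nat
  -- Accuracy `δ²` is chosen because the divergence estimate divides the error by `δ`.
  choose k hks hk0 hki hkγ using fun n => exists_boundedContinuous_weighted_approx hwm hw1 hwi
    (ρ := ρ) (fun x => ENNReal.toReal_nonneg) hρw (γ := δ n ^ 2) (by have := hδpos n; positivity)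
  set h : ℕ → ℝ →ᵇ ℝ := fun n => k n + BoundedContinuousFunction.const ℝ (δ n) with hh
  have hkh (n : ℕ) (x : ℝ) : h n x = k n x + δ n := rfl
  have hδh (n : ℕ) (x : ℝ) : δ n ≤ h n x := by linarith [hk0 n x, hkh n x]
  have hh0 (n : ℕ) (x : ℝ) : 0 ≤ h n x := (hδpos n).le.trans (hδh n x)
  have habs (n : ℕ) : Integrable (fun x => |ρ x - k n x|) (η : Measure ℝ) :=
    (hρi.sub ((k n).integrable _)).abs
  have habs1 (n : ℕ) : ∫ x, |ρ x - k n x| ∂(η : Measure ℝ) ≤ δ n ^ 2 :=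
    (integral_mono (habs n) (hki n) fun x =>
      le_mul_of_one_le_left (abs_nonneg _) (hw1 x)).trans (hkγ n)
  have hlim : Tendsto (fun n => tilt (h n) σ η) atTop (𝓝 κ.toFiniteMeasure) := by
    rw [FiniteMeasure.tendsto_iff_forall_integral_tendsto]
    intro f
    have hf := integrable_rnDeriv_mul_and_singularPart (η := η) (f.integrable (κ : Measure ℝ))
    have hbound (n : ℕ) : ‖∫ x, f x ∂(tilt (h n) σ η : Measure ℝ) - ∫ x, f x ∂(κ : Measure ℝ)‖ ≤
        ‖f‖ * (δ n ^ 2 + δ n) := by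
      rw [integral_tilt_boundedContinuous (hh0 n), integral_eq_rnDeriv_add_singularPart (η := η)
        (f.integrable (κ : Measure ℝ)), hσ, add_sub_add_right_eq_sub,
        ← integral_sub ((h n * f).integrable _) hf.1]
      have hg : Integrable (fun x => ‖f‖ * (|ρ x - k n x| + δ n)) (η : Measure ℝ) :=
        ((habs n).add (integrable_const _)).const_mul _
      refine (norm_integral_le_of_norm_le hg (Eventually.of_forall fun x => ?_)).trans ?_
      · change ‖h n x * f x - ρ x * f x‖ ≤ _
        rw [← sub_mul, norm_mul, mul_comm]
        refine mul_le_mul (f.norm_coe_le_norm x) ?_ (norm_nonneg _) (norm_nonneg _)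
        rw [Real.norm_eq_abs, hkh, abs_sub_comm (ρ x), add_sub_right_comm]
        exact (abs_add_le _ _).trans_eq (by rw [abs_of_pos (hδpos n)])
      · rw [integral_const_mul, integral_add (habs n) (integrable_const _)]
        simp only [integral_const, probReal_univ, one_smul]
        gcongr
        exact habs1 n
    rw [tendsto_iff_norm_sub_tendsto_zero]
    refine squeeze_zero (fun n => norm_nonneg _) hbound ?_
    have : Tendsto (fun n => ‖f‖ * (δ n ^ 2 + δ n)) atTop (𝓝 (‖f‖ * (0 ^ 2 + 0))) :=
      ((hδ0.pow 2).add hδ0).const_mul _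
    simpa using this
  have hmass : Tendsto (fun n => ((tilt (h n) σ η).mass : ℝ)) atTop (𝓝 1) := by
    have := (FiniteMeasure.continuous_mass.tendsto _).comp hlim
    simpa [Function.comp_def] using (NNReal.continuous_coe.tendsto _).comp this
  have hlim' : Tendsto (fun n => (tilt (h n) σ η).normalize) atTop (𝓝 κ) := by
    have := FiniteMeasure.tendsto_normalize_of_tendsto hlim κ.toFiniteMeasure_nonzero
    rwa [ProbabilityMeasure.toFiniteMeasure_normalize_eq_self] at this
  have h1 := hlim'.eventually (eventually_mem_nhds_iff.2 hN)
  have h2 : ∀ᶠ n in atTop, (klDiv (η : Measure ℝ) (κ : Measure ℝ)).toReal + δ n +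
      Real.log ((tilt (h n) σ η).mass : ℝ) < v' := by
    have : Tendsto (fun n => (klDiv (η : Measure ℝ) (κ : Measure ℝ)).toReal + δ n +
      Real.log ((tilt (h n) σ η).mass : ℝ)) atTop
        (𝓝 ((klDiv (η : Measure ℝ) (κ : Measure ℝ)).toReal + 0 + Real.log 1)) :=
      (hδ0.const_add _).add (hmass.log one_ne_zero)
    rw [Real.log_one, add_zero, add_zero] at this
    exact this.eventually_mem (Iio_mem_nhds hKv)
  have h3 : ∀ᶠ n in atTop, ∫ x, |x| ^ (1 + ε) ∂(κ : Measure ℝ) + δ n ^ 2 + δ n * B <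
      B * (tilt (h n) σ η).mass := by
    have ha : Tendsto (fun n => ∫ x, |x| ^ (1 + ε) ∂(κ : Measure ℝ) + δ n ^ 2 + δ n * B) atTop
        (𝓝 (∫ x, |x| ^ (1 + ε) ∂(κ : Measure ℝ) + 0 ^ 2 + 0 * B)) :=
      ((hδ0.pow 2).const_add _).add (hδ0.mul_const B)
    exact ha.eventually_lt (hmass.const_mul B) (by simpa using hκB)
  obtain ⟨n, h1, h2, h3⟩ := (h1.and (h2.and h3)).exists
  have hkl := neg_integral_log_le (hδpos n) (hk0 n) (hkh n) hv.ne_top (habs n)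
  have hdiv : (∫ x, |ρ x - k n x| ∂(η : Measure ℝ)) / δ n ≤ δ n := by
    rw [div_le_iff₀ (hδpos n), ← sq]
    exact habs1 n
  have hσp := (integrable_rnDeriv_mul_and_singularPart (η := η) hpκ)
  refine (eventually_exists_normalize_tilt (σ := σ) (h := h n) hε hB (hks n) (hk0 n) (hδpos n)
    (hkh n) hσp.2 h1 (v := v') (lt_of_le_of_lt ENNReal.toReal_nonneg hKv) (by linarith)
    (lt_of_le_of_lt ?_ h3)).mono fun η' ⟨κ', hκ', hκN, hlt⟩ => ⟨κ', hκ', hκN, hlt.trans hv'v⟩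
  have hkp : Integrable (fun x => k n x * |x| ^ (1 + ε)) (η : Measure ℝ) :=
    hpη.bdd_mul (c := ‖k n‖) (k n).continuous.aestronglyMeasurable
      (Eventually.of_forall (k n).norm_coe_le_norm)
  have h4 : ∫ x, k n x * |x| ^ (1 + ε) ∂(η : Measure ℝ) ≤
      ∫ x, ρ x * |x| ^ (1 + ε) ∂(η : Measure ℝ) + ∫ x, w x * |ρ x - k n x| ∂(η : Measure ℝ) := by
    rw [← integral_add hσp.1 (hki n)]
    refine integral_mono hkp (hσp.1.add (hki n)) fun x => ?_
    have hx : 0 ≤ |x| ^ (1 + ε) := by positivity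
    have := neg_abs_le (ρ x - k n x)
    have := mul_nonneg hx (show 0 ≤ ρ x - k n x + |ρ x - k n x| by linarith)
    have := abs_nonneg (ρ x - k n x)
    simp only [hw]
    linarith
  rw [integral_eq_rnDeriv_add_singularPart (η := η) hpκ, hσ]
  linarith [hkγ n]

end Approximation

/-! ### Sharp bounds on CVaR over the moment class -/

section Bounds

variable {ε B π : ℝ} {η κ : ProbabilityMeasure ℝ}

/-- The tangent line inequality for `x ↦ |x|^(1+ε)` at `c`. -/
theorem abs_le_tangent (hε : 0 < ε) {c : ℝ} (hc : 0 < c) (x : ℝ) :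
    |x| ≤ (1 - 1 / (1 + ε)) * c + |x| ^ (1 + ε) / ((1 + ε) * c ^ ε) := by
  have hpow : 0 < c ^ ε := Real.rpow_pos_of_pos hc ε
  have h := one_add_mul_self_le_rpow_one_add (s := |x| / c - 1)
    (by linarith [show 0 ≤ |x| / c by positivity]) (p := 1 + ε) (by linarith)
  rw [add_sub_cancel, Real.div_rpow (abs_nonneg x) hc.le, Real.rpow_add hc, Real.rpow_one,
    le_div_iff₀ (by positivity)] at h
  rw [← sub_le_iff_le_add', le_div_iff₀ (by positivity)]
  refine le_trans (le_of_eq ?_) h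
  field_simp
  ring

theorem abs_lt_tangent (hε : 0 < ε) {c : ℝ} (hc : 0 < c) {x : ℝ} (hx : |x| ≠ c) :
    |x| < (1 - 1 / (1 + ε)) * c + |x| ^ (1 + ε) / ((1 + ε) * c ^ ε) := by
  have hpow : 0 < c ^ ε := Real.rpow_pos_of_pos hc ε
  have h := one_add_mul_self_lt_rpow_one_add (s := |x| / c - 1)
    (by linarith [show 0 ≤ |x| / c by positivity]) (by
      rw [sub_ne_zero, ne_eq, div_eq_one_iff_eq hc.ne']
      exact hx) (p := 1 + ε) (by linarith)
  rw [add_sub_cancel, Real.div_rpow (abs_nonneg x) hc.le, Real.rpow_add hc, Real.rpow_one,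
    lt_div_iff₀ (by positivity)] at h
  rw [← sub_lt_iff_lt_add', lt_div_iff₀ (by positivity)]
  refine lt_of_le_of_lt (le_of_eq ?_) h
  field_simp
  ring

theorem integral_tangent_le (hε : 0 < ε) (hB : 0 ≤ B) (hη : η ∈ momentClass ε B) {c r : ℝ}
    (hc : 0 < c) (hcB : B ≤ r * c ^ (1 + ε)) :
    ∫ x, |x| ^ (1 + ε) / ((1 + ε) * c ^ ε) ∂(η : Measure ℝ) ≤ r * (1 / (1 + ε) * c) := by
  have hpow : 0 < c ^ ε := Real.rpow_pos_of_pos hc ε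
  rw [integral_div, div_le_iff₀ (by positivity)]
  refine (integral_abs_rpow_le hε hB hη).trans (hcB.trans (le_of_eq ?_))
  rw [Real.rpow_add hc, Real.rpow_one]
  field_simp

/-- The threshold is the constant term of the tangent line at `c`, so `(x - z)⁺` is bounded by the
pure power term, whose mean is at most `(1 - π) c / (1 + ε)`. -/
theorem ruObj_le_of_le (hε : 0 < ε) (hB : 0 ≤ B) (hπ1 : π < 1) (hη : η ∈ momentClass ε B)
    {c : ℝ} (hc : 0 < c) (hcB : B ≤ (1 - π) * c ^ (1 + ε)) :
    ruObj π η ((1 - 1 / (1 + ε)) * c) ≤ c := by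
  have hpos : 0 < 1 - π := by linarith
  have h1 : ∫ x, max (x - (1 - 1 / (1 + ε)) * c) 0 ∂(η : Measure ℝ) ≤
      (1 - π) * (1 / (1 + ε) * c) := by
    refine le_trans (integral_mono (integrable_posPart (integrable_id_of_mem hε hη) _)
      ((integrable_abs_rpow hε hη).div_const _) fun x => ?_)
      (integral_tangent_le hε hB hη hc hcB)
    have := abs_le_tangent hε hc x
    exact max_le (by linarith [le_abs_self x]) (by positivity)
  rw [mul_comm (1 - π), ← div_le_iff₀ hpos] at h1
  unfold ruObj
  linarith

/-- The largest conditional value-at-risk of a measure in the moment class. -/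
def cvarMax (ε B π : ℝ) : ℝ := (B / (1 - π)) ^ (1 / (1 + ε))

theorem rpow_one_div_rpow (hε : 0 < ε) {a : ℝ} (ha : 0 ≤ a) :
    (a ^ (1 / (1 + ε))) ^ (1 + ε) = a := by
  rw [← Real.rpow_mul ha, one_div_mul_cancel (by linarith), Real.rpow_one]

theorem cvarMax_pos (hB : 0 < B) (hπ1 : π < 1) : 0 < cvarMax ε B π :=
  Real.rpow_pos_of_pos (div_pos hB (by linarith)) _

theorem mul_cvarMax_rpow (hε : 0 < ε) (hB : 0 < B) (hπ1 : π < 1) :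
    (1 - π) * cvarMax ε B π ^ (1 + ε) = B := by
  have hpos : 0 < 1 - π := by linarith
  rw [cvarMax, rpow_one_div_rpow hε (by positivity)]
  field_simp

theorem CVaR_le_cvarMax (hε : 0 < ε) (hB : 0 < B) (hπ0 : 0 < π) (hπ1 : π < 1)
    (hη : η ∈ momentClass ε B) : CVaR π η ≤ cvarMax ε B π :=
  (CVaR_le_ruObj hπ0 hπ1 (integrable_id_of_mem hε hη) _).trans
    (ruObj_le_of_le hε hB.le hπ1 hη (cvarMax_pos hB hπ1) (mul_cvarMax_rpow hε hB hπ1).ge)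

theorem integral_abs_le_rpow (hε : 0 < ε) (hB : 0 < B) (hη : η ∈ momentClass ε B) :
    ∫ x, |x| ∂(η : Measure ℝ) ≤ B ^ (1 / (1 + ε)) := by
  set b := B ^ (1 / (1 + ε)) with hb
  have hbpos : 0 < b := Real.rpow_pos_of_pos hB _
  have h1 := integral_tangent_le hε hB.le hη hbpos (r := 1)
    (by rw [hb, rpow_one_div_rpow hε hB.le, one_mul])
  have hint : Integrable (fun x => |x| ^ (1 + ε) / ((1 + ε) * b ^ ε)) (η : Measure ℝ) :=
    (integrable_abs_rpow hε hη).div_const _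
  have h2 := integral_mono (integrable_id_of_mem hε hη).abs ((integrable_const _).add hint)
    (abs_le_tangent hε hbpos)
  have h3 := integral_add (integrable_const ((1 - 1 / (1 + ε)) * b)) hint
  simp only [integral_const, probReal_univ, one_smul] at h3
  simp only [Pi.add_apply] at h2
  linarith

/-- CVaR dominates the mean, and the mean is at least `-E|X|`. -/
theorem neg_rpow_le_CVaR (hε : 0 < ε) (hB : 0 < B) (hπ0 : 0 < π) (hπ1 : π < 1)
    (hη : η ∈ momentClass ε B) : -B ^ (1 / (1 + ε)) ≤ CVaR π η := by
  have hid := integrable_id_of_mem hε hη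
  have hpos : 0 < 1 - π := by linarith
  rw [CVaR_eq_ruObj hπ1 hid]
  set z := VaR π η with hz
  have h1 : ∫ x, (-|x| - z) ∂(η : Measure ℝ) ≤ ∫ x, max (x - z) 0 ∂(η : Measure ℝ) :=
    integral_mono (hid.abs.neg.sub (integrable_const _)) (integrable_posPart hid _)
      fun x => le_trans (by simpa using neg_abs_le x) (le_max_left _ _)
  have h2 : Integrable (fun x : ℝ => -|x|) (η : Measure ℝ) := hid.abs.neg
  rw [integral_sub h2 (integrable_const _), integral_neg, integral_const,
    probReal_univ, one_smul] at h1
  have h3 : ∫ x, max (x - z) 0 ∂(η : Measure ℝ) ≤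
      (∫ x, max (x - z) 0 ∂(η : Measure ℝ)) / (1 - π) :=
    le_div_self (integral_nonneg fun x => le_max_right _ _) hpos (by linarith)
  have h4 := integral_abs_le_rpow hε hB hη
  unfold ruObj
  linarith

end Bounds

/-! ### Point masses and a nearly extremal measure -/

section PointMass

variable {ε B π : ℝ} {η κ : ProbabilityMeasure ℝ} {a : ℝ}

/-- The point mass at `a`. -/
def pointMass (a : ℝ) : ProbabilityMeasure ℝ := ⟨Measure.dirac a, inferInstance⟩

theorem coe_pointMass : (pointMass a : Measure ℝ) = Measure.dirac a := rfl

theorem ruObj_pointMass (z : ℝ) : ruObj π (pointMass a) z = z + max (a - z) 0 / (1 - π) := by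
  rw [ruObj, coe_pointMass, integral_dirac]

theorem integral_abs_rpow_pointMass :
    ∫ x, |x| ^ (1 + ε) ∂(pointMass a : Measure ℝ) = |a| ^ (1 + ε) := by
  rw [coe_pointMass, integral_dirac]

theorem pointMass_mem_momentClass (h : |a| ^ (1 + ε) ≤ B) : pointMass a ∈ momentClass ε B :=
  mem_momentClass_of_integral_le (integrable_dirac (by simp))
    (integral_abs_rpow_pointMass.trans_le h)

theorem exists_mem_lt_CVaR (hε : 0 < ε) (hB : 0 < B) (hπ0 : 0 < π) (hπ1 : π < 1) {y : ℝ}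
    (hy : y < cvarMax ε B π) : ∃ κ ∈ momentClass ε B,
      ∫ x, |x| ^ (1 + ε) ∂(κ : Measure ℝ) < B ∧ y < CVaR π κ := by
  have hpos : 0 < 1 - π := by linarith
  obtain ⟨c, hc, hcm⟩ := exists_between (max_lt hy (cvarMax_pos hB hπ1))
  obtain ⟨hyc, hc0⟩ := max_lt_iff.1 hc
  -- Mass `π` at `0` and `1 - π` at `c`: at `c = cvarMax` the moment would be exactly `B`, so a
  -- smaller `c` leaves slack.
  let s : unitInterval := ⟨1 - π, hpos.le, by linarith⟩
  have hs : (s : ℝ) = 1 - π := rfl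
  have hi (f : ℝ → ℝ) (a : ℝ) : Integrable f (pointMass a : Measure ℝ) := integrable_dirac (by simp)
  have hmom : ∫ x, |x| ^ (1 + ε) ∂(mix s (pointMass 0) (pointMass c) : Measure ℝ) < B := by
    rw [integral_mix (hi _ _) (hi _ _), integral_abs_rpow_pointMass, integral_abs_rpow_pointMass,
      abs_zero, Real.zero_rpow (by linarith), abs_of_pos hc0, hs, mul_zero, zero_add]
    refine lt_of_lt_of_eq ?_ (mul_cvarMax_rpow hε hB hπ1)
    exact mul_lt_mul_of_pos_left (Real.rpow_lt_rpow hc0.le hcm (by linarith)) hpos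
  have hI : Integrable (fun x => |x| ^ (1 + ε)) (mix s (pointMass 0) (pointMass c) : Measure ℝ) :=
    integrable_mix (hi _ _) (hi _ _)
  refine ⟨mix s (pointMass 0) (pointMass c), mem_momentClass_of_integral_le hI hmom.le, hmom, ?_⟩
  rw [CVaR_eq_ruObj hπ1 (integrable_mix (hi _ _) (hi _ _)), ruObj_mix (hi _ _) (hi _ _)]
  refine hyc.trans_le ?_
  -- The lower bound holds at every threshold, so the value-at-risk need not be computed.
  generalize VaR π _ = z
  rw [ruObj_pointMass, ruObj_pointMass, hs]
  have h1 : 0 ≤ (1 - (1 - π)) * (max (0 - z) 0 / (1 - π)) := by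
    have : 0 ≤ max (0 - z) 0 := le_max_right _ _
    rw [sub_sub_cancel]
    positivity
  have h2 : (1 - π) * (max (c - z) 0 / (1 - π)) = max (c - z) 0 := by field_simp
  have h3 := le_max_left (c - z) 0
  linarith

end PointMass

/-! ### Finiteness and upper semicontinuity of `KLinfU` and `KLinfL` -/

section Projection

variable {ε B π : ℝ} {η κ : ProbabilityMeasure ℝ} {v : ℝ≥0∞}

theorem KLinfU_le (hκ : κ ∈ momentClass ε B) {y : ℝ} (hy : y ≤ CVaR π κ) :
    KLinfU ε B π η y ≤ klDiv (η : Measure ℝ) (κ : Measure ℝ) :=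
  iInf₂_le_of_le κ hκ (iInf_le _ hy)

theorem KLinfL_le (hκ : κ ∈ momentClass ε B) {x : ℝ} (hx : CVaR π κ ≤ x) :
    KLinfL ε B π η x ≤ klDiv (η : Measure ℝ) (κ : Measure ℝ) :=
  iInf₂_le_of_le κ hκ (iInf_le _ hx)

theorem exists_of_KLinfU_lt {y : ℝ} (h : KLinfU ε B π η y < v) :
    ∃ κ ∈ momentClass ε B, y ≤ CVaR π κ ∧ klDiv (η : Measure ℝ) (κ : Measure ℝ) < v := by
  simpa [KLinfU, iInf_lt_iff, and_left_comm] using h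

theorem exists_of_KLinfL_lt {x : ℝ} (h : KLinfL ε B π η x < v) :
    ∃ κ ∈ momentClass ε B, CVaR π κ ≤ x ∧ klDiv (η : Measure ℝ) (κ : Measure ℝ) < v := by
  simpa [KLinfL, iInf_lt_iff, and_left_comm] using h

theorem KLinfU_eq_zero (hη : η ∈ momentClass ε B) {y : ℝ} (hy : y ≤ CVaR π η) :
    KLinfU ε B π η y = 0 :=
  le_antisymm ((KLinfU_le hη hy).trans (klDiv_self _).le) zero_le

theorem KLinfL_eq_zero (hη : η ∈ momentClass ε B) {x : ℝ} (hx : CVaR π η ≤ x) :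
    KLinfL ε B π η x = 0 :=
  le_antisymm ((KLinfL_le hη hx).trans (klDiv_self _).le) zero_le

theorem KLinfU_mono {y y' : ℝ} (h : y ≤ y') : KLinfU ε B π η y ≤ KLinfU ε B π η y' := by
  refine le_iInf₂ fun κ hκ => le_iInf fun hy => KLinfU_le hκ (h.trans hy)

theorem KLinfL_anti {x x' : ℝ} (h : x ≤ x') : KLinfL ε B π η x' ≤ KLinfL ε B π η x := by
  refine le_iInf₂ fun κ hκ => le_iInf fun hx => KLinfL_le hκ (hx.trans h)

theorem exists_mix_weight {A a y : ℝ} (h : a < y) :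
    ∃ s : unitInterval, (s : ℝ) < 1 ∧ (1 - s) * A + s * a < y := by
  have hc : Continuous fun s : ℝ => (1 - s) * A + s * a := by fun_prop
  have h1 : ∀ᶠ s : ℝ in 𝓝[<] 1, (1 - s) * A + s * a < y :=
    (hc.continuousAt.mono_left nhdsWithin_le_nhds).eventually_mem
      (Iio_mem_nhds (by simpa using h))
  obtain ⟨s, hs, hs'⟩ := (h1.and (Ioo_mem_nhdsLT (zero_lt_one' ℝ))).exists
  exact ⟨⟨s, hs'.1.le, hs'.2.le⟩, hs'.2, hs⟩

theorem klDiv_mix_self_lt_top {s : unitInterval} (hs : (s : ℝ) < 1) (κ₀ : ProbabilityMeasure ℝ) :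
    klDiv (η : Measure ℝ) (mix s η κ₀ : Measure ℝ) < ∞ :=
  (klDiv_mix_le η hs (by rw [klDiv_self]; exact ENNReal.zero_ne_top)).trans_lt
    ENNReal.ofReal_lt_top

/-- Mixing `η` itself into a measure with CVaR above `y` keeps the divergence from `η` finite; by
concavity, a weight of `η` small enough keeps the CVaR above `y`. -/
theorem KLinfU_lt_top (hε : 0 < ε) (hB : 0 < B) (hπ0 : 0 < π) (hπ1 : π < 1)
    (hη : η ∈ momentClass ε B) {y : ℝ} (hy : y < cvarMax ε B π) : KLinfU ε B π η y < ∞ := by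
  obtain ⟨κ₀, hκ₀, -, hyκ⟩ := exists_mem_lt_CVaR hε hB hπ0 hπ1 hy
  obtain ⟨s, hs, hsy⟩ := exists_mix_weight (A := -CVaR π η) (neg_lt_neg hyκ)
  refine (KLinfU_le (mix_mem_momentClass (s := s) hε hB.le hη hκ₀) ?_).trans_lt
    (klDiv_mix_self_lt_top hs κ₀)
  have := le_CVaR_mix (s := s) hπ0 hπ1 (integrable_id_of_mem hε hη) (integrable_id_of_mem hε hκ₀)
  linarith

theorem exists_abs_rpow_lt (hε : 0 < ε) (hB : 0 < B) {x : ℝ} (hx : -B ^ (1 / (1 + ε)) < x) :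
    ∃ m, -B ^ (1 / (1 + ε)) < m ∧ m < x ∧ |m| ^ (1 + ε) < B := by
  have hb : 0 < B ^ (1 / (1 + ε)) := Real.rpow_pos_of_pos hB _
  obtain ⟨m, hm, hmx⟩ := exists_between (lt_min hx (show -B ^ (1 / (1 + ε)) < B ^ (1 / (1 + ε)) by
    linarith))
  obtain ⟨h1, h2⟩ := lt_min_iff.1 hmx
  refine ⟨m, hm, h1, ?_⟩
  have h3 := Real.rpow_lt_rpow (abs_nonneg m) (abs_lt.2 ⟨hm, h2⟩) (show 0 < 1 + ε by linarith)
  rwa [rpow_one_div_rpow hε hB.le] at h3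

/-- Concavity is of no help in bounding the CVaR of a mixture from above; instead the affine
objective is evaluated at the fixed threshold `m`, where the point mass at `m` has value `m`. -/
theorem KLinfL_lt_top (hε : 0 < ε) (hB : 0 < B) (hπ0 : 0 < π) (hπ1 : π < 1)
    (hη : η ∈ momentClass ε B) {x : ℝ} (hx : -B ^ (1 / (1 + ε)) < x) :
    KLinfL ε B π η x < ∞ := by
  obtain ⟨m, -, hmx, hm⟩ := exists_abs_rpow_lt hε hB hx
  have hκ₀ : pointMass m ∈ momentClass ε B := pointMass_mem_momentClass hm.le
  obtain ⟨s, hs, hsx⟩ := exists_mix_weight (A := ruObj π η m) hmx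
  have hid := integrable_id_of_mem hε hη
  have hid₀ := integrable_id_of_mem hε hκ₀
  refine (KLinfL_le (mix_mem_momentClass (s := s) hε hB.le hη hκ₀) ?_).trans_lt
    (klDiv_mix_self_lt_top hs _)
  refine (CVaR_le_ruObj hπ0 hπ1 (integrable_mix (s := s) hid hid₀) m).trans ?_
  rw [ruObj_mix hid hid₀, ruObj_pointMass, sub_self, max_self, zero_div, add_zero]
  exact hsx.le

/-- Mixing with a nearly extremal measure gives strict slack in both constraints, so the alternative
can be transported. The slack in CVaR also yields a level `y' > y`, needed when the level must
exceed the moving CVaR of another arm. -/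
theorem eventually_KLinfU_lt (hε : 0 < ε) (hB : 0 < B) (hπ0 : 0 < π) (hπ1 : π < 1)
    (hη : η ∈ momentClass ε B) {y : ℝ} (hy : y < cvarMax ε B π) (hv : KLinfU ε B π η y < v) :
    ∃ y' > y, ∀ᶠ η' : ProbabilityMeasure ℝ in 𝓝[momentClass ε B] η, KLinfU ε B π η' y' < v := by
  obtain ⟨κ, hκ, hyκ, hκv⟩ := exists_of_KLinfU_lt hv
  obtain ⟨κ₀, hκ₀, hmom₀, hyκ₀⟩ := exists_mem_lt_CVaR hε hB hπ0 hπ1 hy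
  obtain ⟨s, hs0, hs1, hsv⟩ := exists_klDiv_mix_lt hκv κ₀
  have hmem := mix_mem_momentClass (s := s) hε hB.le hκ hκ₀
  have hmom := integral_abs_rpow_mix_lt hε hB.le hs0 hκ hκ₀ hmom₀
  have hlt : y < CVaR π (mix s κ κ₀) := by
    refine lt_of_lt_of_le ?_
      (le_CVaR_mix hπ0 hπ1 (integrable_id_of_mem hε hκ) (integrable_id_of_mem hε hκ₀))
    have h1 := mul_le_mul_of_nonneg_left hyκ (show 0 ≤ 1 - (s : ℝ) by linarith)
    have h2 := mul_lt_mul_of_pos_left hyκ₀ hs0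
    linarith
  obtain ⟨y', hyy', hy'⟩ := exists_between hlt
  obtain ⟨N, hN, hNsub⟩ := mem_nhdsWithin_iff_exists_mem_nhds_inter.1
    ((continuousOn_CVaR hε hB.le hπ0 hπ1 _ hmem).eventually_mem (Ioi_mem_nhds hy'))
  refine ⟨y', hyy', (eventually_exists_klDiv_lt hε hB.le hη hmem hmom hsv hN).mono ?_⟩
  rintro η' ⟨κ', hκ', hκN, hlt'⟩
  have : y' < CVaR π κ' := hNsub ⟨hκN, hκ'⟩
  exact (KLinfU_le hκ' this.le).trans_lt hlt'

theorem ruObj_eq_self_of_ae_le {z : ℝ} (h : ∀ᵐ x ∂(η : Measure ℝ), x ≤ z) : ruObj π η z = z := by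
  have : ∫ x, max (x - z) 0 ∂(η : Measure ℝ) = 0 :=
    integral_eq_zero_of_ae (h.mono fun x hx => max_eq_right (by linarith))
  rw [ruObj, this, zero_div, add_zero]

/-- Equality would leave `κ` no mass above `x`, hence `η` none either by absolute continuity,
forcing `c_π(η) ≤ x`. -/
theorem VaR_lt_of_CVaR_lt (hπ0 : 0 < π) (hπ1 : π < 1)
    (hη : Integrable (fun x => x) (η : Measure ℝ)) (hκ : Integrable (fun x => x) (κ : Measure ℝ))
    (hac : (η : Measure ℝ) ≪ (κ : Measure ℝ)) {x : ℝ} (hκx : CVaR π κ ≤ x) (hxη : x < CVaR π η) :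
    VaR π κ < x := by
  have hpos : 0 < 1 - π := by linarith
  refine lt_of_le_of_ne ((VaR_le_CVaR hπ1 hκ).trans hκx) fun heq => ?_
  rw [CVaR_eq_ruObj hπ1 hκ, heq, ruObj] at hκx
  have h0 : 0 ≤ ∫ y, max (y - x) 0 ∂(κ : Measure ℝ) := integral_nonneg fun y => le_max_right _ _
  have h1 : ∫ y, max (y - x) 0 ∂(κ : Measure ℝ) = 0 := by
    refine le_antisymm ?_ h0
    by_contra! hlt
    linarith [div_pos hlt hpos]
  have h2 : ∀ᵐ y ∂(κ : Measure ℝ), y ≤ x := ((integral_eq_zero_iff_of_nonneg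
    (f := fun y => max (y - x) 0) (fun y => le_max_right _ _)
    (integrable_posPart hκ x)).1 h1).mono fun y hy => by
    have : max (y - x) 0 = 0 := hy
    linarith [le_max_left (y - x) 0]
  have h3 := CVaR_le_ruObj hπ0 hπ1 hη x
  rw [ruObj_eq_self_of_ae_le (hac.ae_le h2)] at h3
  linarith

/-- The expression is at least the mean of `κ`, so at least `-b`, where `b = B^(1/(1+ε))`. Equality
in the tangent bound puts `κ`, and with it `η`, on `(-∞, -b]`, against `hlt`. The strict gap leaves
room for a point mass with moment below `B`. -/
theorem neg_rpow_lt_add_integral (hε : 0 < ε) (hB : 0 < B) (hπ0 : 0 < π) (hπ1 : π < 1)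
    (hη : η ∈ momentClass ε B) (hκ : κ ∈ momentClass ε B)
    (hac : (η : Measure ℝ) ≪ (κ : Measure ℝ)) (hlt : -B ^ (1 / (1 + ε)) < CVaR π η) (z : ℝ) :
    -B ^ (1 / (1 + ε)) < z + ∫ x, max (x - z) 0 ∂(κ : Measure ℝ) := by
  set b := B ^ (1 / (1 + ε)) with hb
  have hbpos : 0 < b := Real.rpow_pos_of_pos hB _
  by_contra! hle
  have hid := integrable_id_of_mem hε hκ
  have h1 := integral_tangent_le hε hB.le hκ hbpos (r := 1)
    (by rw [hb, rpow_one_div_rpow hε hB.le, one_mul])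
  have hint : Integrable (fun x => |x| ^ (1 + ε) / ((1 + ε) * b ^ ε)) (κ : Measure ℝ) :=
    (integrable_abs_rpow hε hκ).div_const _
  set φ : ℝ → ℝ := fun x =>
    (|x| ^ (1 + ε) / ((1 + ε) * b ^ ε) + max (x - z) 0) + ((1 - 1 / (1 + ε)) * b + z) with hφ
  have hsum : Integrable (fun x => |x| ^ (1 + ε) / ((1 + ε) * b ^ ε) + max (x - z) 0)
    (κ : Measure ℝ) := hint.add (integrable_posPart hid z)
  have hφi : Integrable φ (κ : Measure ℝ) := hsum.add (integrable_const _)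
  have hφ0 (x : ℝ) : 0 ≤ φ x := by
    have h2 := abs_le_tangent hε hbpos x
    have h3 := le_max_left (x - z) 0
    have h4 := neg_abs_le x
    simp only [hφ]
    linarith
  have hφI : ∫ x, φ x ∂(κ : Measure ℝ) = 0 := by
    refine le_antisymm ?_ (integral_nonneg hφ0)
    simp only [hφ]
    rw [integral_add hsum (integrable_const _), integral_add hint (integrable_posPart hid z),
      integral_const, probReal_univ, one_smul]
    linarith
  rw [integral_eq_zero_iff_of_nonneg hφ0 hφi] at hφI
  have h2 : ∀ᵐ x ∂(κ : Measure ℝ), x ≤ -b := hφI.mono fun x hx => by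
    have hx : φ x = 0 := hx
    simp only [hφ] at hx
    have h3 := le_max_left (x - z) 0
    have h4 := neg_abs_le x
    by_cases hxb : |x| = b
    · have h2 := abs_le_tangent hε hbpos x
      linarith
    · have h2 := abs_lt_tangent hε hbpos hxb
      linarith
  have h3 := CVaR_le_ruObj hπ0 hπ1 (integrable_id_of_mem hε hη) (-b)
  rw [ruObj_eq_self_of_ae_le (hac.ae_le h2)] at h3
  linarith

/-- Slack comes from a point mass at `m` whose objective at the threshold `z = VaR π κ` is below
`x`: for `m ≤ z` it equals `z < x`, and for `m > z` it is below that of `κ`, as `m - z` is less than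
the mean excess of `κ`. -/
theorem eventually_KLinfL_lt (hε : 0 < ε) (hB : 0 < B) (hπ0 : 0 < π) (hπ1 : π < 1)
    (hη : η ∈ momentClass ε B) {x : ℝ} (hx : -B ^ (1 / (1 + ε)) < x) (hxη : x < CVaR π η)
    (hv : KLinfL ε B π η x < v) :
    ∀ᶠ η' : ProbabilityMeasure ℝ in 𝓝[momentClass ε B] η, KLinfL ε B π η' x < v := by
  have hpos : 0 < 1 - π := by linarith
  obtain ⟨κ, hκ, hκx, hκv⟩ := exists_of_KLinfL_lt hv
  have hac : (η : Measure ℝ) ≪ (κ : Measure ℝ) := (klDiv_ne_top_iff.1 hκv.ne_top).1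
  have hidκ := integrable_id_of_mem hε hκ
  set z := VaR π κ with hz
  have hzx : z < x := VaR_lt_of_CVaR_lt hπ0 hπ1 (integrable_id_of_mem hε hη) hidκ hac hκx hxη
  have hm := neg_rpow_lt_add_integral hε hB hπ0 hπ1 hη hκ hac (hx.trans hxη) z
  obtain ⟨m, -, hm, hmB⟩ := exists_abs_rpow_lt hε hB hm
  have hκ₀ : pointMass m ∈ momentClass ε B := pointMass_mem_momentClass hmB.le
  have hidκ₀ := integrable_id_of_mem hε hκ₀
  obtain ⟨s, hs0, hs1, hsv⟩ := exists_klDiv_mix_lt hκv (pointMass m)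
  have hmem := mix_mem_momentClass (s := s) hε hB.le hκ hκ₀
  have hmom := integral_abs_rpow_mix_lt hε hB.le hs0 hκ hκ₀
    (integral_abs_rpow_pointMass.trans_lt hmB)
  have hκz : ruObj π κ z ≤ x := by rwa [← CVaR_eq_ruObj hπ1 hidκ]
  have h₀ : ruObj π (pointMass m) z < x := by
    rw [ruObj_pointMass]
    rcases le_total m z with hmz | hmz
    · rw [max_eq_right (by linarith), zero_div, add_zero]
      exact hzx
    · rw [max_eq_left (by linarith)]
      refine lt_of_lt_of_le ?_ hκz
      have := div_lt_div_of_pos_right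
        (show m - z < ∫ x, max (x - z) 0 ∂(κ : Measure ℝ) by linarith) hpos
      unfold ruObj
      linarith
  have hlt : CVaR π (mix s κ (pointMass m)) < x := by
    refine (CVaR_le_ruObj hπ0 hπ1 (integrable_mix (s := s) hidκ hidκ₀) z).trans_lt ?_
    rw [ruObj_mix hidκ hidκ₀]
    have h1 := mul_le_mul_of_nonneg_left hκz (show 0 ≤ 1 - (s : ℝ) by linarith)
    have h2 := mul_lt_mul_of_pos_left h₀ hs0
    linarith
  obtain ⟨N, hN, hNsub⟩ := mem_nhdsWithin_iff_exists_mem_nhds_inter.1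
    ((continuousOn_CVaR hε hB.le hπ0 hπ1 _ hmem).eventually_mem (Iio_mem_nhds hlt))
  refine (eventually_exists_klDiv_lt hε hB.le hη hmem hmom hsv hN).mono ?_
  rintro η' ⟨κ', hκ', hκN, hlt'⟩
  have : CVaR π κ' < x := hNsub ⟨hκN, hκ'⟩
  exact (KLinfL_le hκ' this.le).trans_lt hlt'

/-- `KLinfL` is left continuous at the conditional value-at-risk of a measure for which the latter
is maximal. -/
theorem exists_KLinfL_lt_of_cvarMax_le (hε : 0 < ε) (hB : 0 < B) (hπ0 : 0 < π) (hπ1 : π < 1)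
    (hη : η ∈ momentClass ε B) (hmax : cvarMax ε B π ≤ CVaR π η) (hv : 0 < v) :
    ∃ x < CVaR π η, KLinfL ε B π η x < v := by
  have hcpos := cvarMax_pos (ε := ε) hB hπ1
  set c := cvarMax ε B π with hc
  have hid := integrable_id_of_mem hε hη
  have hκ₀ : pointMass 0 ∈ momentClass ε B := pointMass_mem_momentClass (by
    rw [abs_zero, Real.zero_rpow (by linarith)]; exact hB.le)
  have hid₀ := integrable_id_of_mem hε hκ₀
  have hz := ruObj_le_of_le hε hB.le hπ1 hη hcpos (mul_cvarMax_rpow hε hB hπ1).ge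
  have hfrac : 0 < 1 / (1 + ε) := by positivity
  have hfrac1 : 1 / (1 + ε) < 1 := by rw [div_lt_one (by linarith)]; linarith
  -- At this threshold the objective of `η` is at most `c`, while that of the point mass at `0`
  -- equals `z < c`; so any mixing strictly lowers the CVaR.
  set z := (1 - 1 / (1 + ε)) * c with hzdef
  have hz0 : 0 < z := mul_pos (by linarith) hcpos
  have hzc : z < c := by nlinarith
  obtain ⟨s, hs0, hs1, hsv⟩ := exists_klDiv_mix_lt (η := η) (κ := η) (v := v)
    (by rwa [klDiv_self]) (pointMass 0)
  refine ⟨CVaR π (mix s η (pointMass 0)), ?_,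
    (KLinfL_le (mix_mem_momentClass (s := s) hε hB.le hη hκ₀) le_rfl).trans_lt hsv⟩
  refine ((CVaR_le_ruObj hπ0 hπ1 (integrable_mix (s := s) hid hid₀) z).trans_lt ?_).trans_le hmax
  rw [ruObj_mix hid hid₀, ruObj_pointMass, max_eq_right (by linarith), zero_div, add_zero]
  have h1 := mul_le_mul_of_nonneg_left hz (show 0 ≤ 1 - (s : ℝ) by linarith)
  have h2 := mul_lt_mul_of_pos_left hzc hs0
  linarith

end Projection

/-! ### Strict inequalities in `ℝ≥0∞` under small increases -/

theorem exists_gt_mul_add_mul_lt {a u b l v : ℝ≥0∞} (ha : a ≠ ∞) (hu : u ≠ ∞) (hb : b ≠ ∞)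
    (hl : l ≠ ∞) (h : a * u + b * l < v) :
    ∃ a' > a, ∃ u' > u, ∃ b' > b, ∃ l' > l, a' * u' + b' * l' < v := by
  lift a to ℝ≥0 using ha
  lift u to ℝ≥0 using hu
  lift b to ℝ≥0 using hb
  lift l to ℝ≥0 using hl
  have hc : Continuous fun δ : ℝ≥0 =>
      (((a + δ) * (u + δ) + (b + δ) * (l + δ) : ℝ≥0) : ℝ≥0∞) := by fun_prop
  have h1 : ∀ᶠ δ : ℝ≥0 in 𝓝[>] 0,
      (((a + δ) * (u + δ) + (b + δ) * (l + δ) : ℝ≥0) : ℝ≥0∞) < v :=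
    (hc.continuousAt.mono_left nhdsWithin_le_nhds).eventually_mem (Iio_mem_nhds (by
      simpa using h))
  obtain ⟨δ, hδv, hδ⟩ := (h1.and self_mem_nhdsWithin).exists
  have hδ : 0 < δ := hδ
  have hlt (r : ℝ≥0) : (r : ℝ≥0∞) < ((r + δ : ℝ≥0) : ℝ≥0∞) := by
    exact_mod_cast lt_add_of_pos_right r hδ
  exact ⟨_, hlt a, _, hlt u, _, hlt b, _, hlt l, by exact_mod_cast hδv⟩

theorem exists_pos_add_mul_lt {w b v : ℝ≥0∞} (hb : b ≠ ∞) (h : w < v) :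
    ∃ l > 0, w + b * l < v := by
  obtain ⟨a', ha, u', hu, b', hb', l', hl, hlt⟩ := exists_gt_mul_add_mul_lt (a := 1) (u := w)
    (b := b) (l := 0) (v := v) ENNReal.one_ne_top h.ne_top hb ENNReal.zero_ne_top (by simpa using h)
  refine ⟨l', hl, lt_of_le_of_lt ?_ hlt⟩
  gcongr
  calc w = 1 * w := (one_mul w).symm
    _ ≤ a' * u' := mul_le_mul' ha.le hu.le

/-! ### Semicontinuity of the objective -/

section Objective

variable {K : ℕ} {ε B π : ℝ} {ν : Fin K → ProbabilityMeasure ℝ} {j a : Fin K} {t : Fin K → ℝ}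

theorem lowerBoundObjective_le (haj : a ≠ j) {x y : ℝ} (hxy : x ≤ y) :
    lowerBoundObjective ε B π j ν t ≤ ENNReal.ofReal (t j) * KLinfU ε B π (ν j) y +
      ENNReal.ofReal (t a) * KLinfL ε B π (ν a) x :=
  iInf₂_le_of_le a haj (iInf₂_le_of_le x y (iInf_le _ hxy))

theorem exists_of_lowerBoundObjective_lt {v : ℝ≥0∞} (h : lowerBoundObjective ε B π j ν t < v) :
    ∃ a, a ≠ j ∧ ∃ x y, x ≤ y ∧ ENNReal.ofReal (t j) * KLinfU ε B π (ν j) y +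
      ENNReal.ofReal (t a) * KLinfL ε B π (ν a) x < v := by
  simp only [lowerBoundObjective, iInf_lt_iff] at h
  obtain ⟨a, ha, x, y, hxy, hlt⟩ := h
  exact ⟨a, ha, x, y, hxy, hlt⟩

theorem lowerBoundObjective_le_value (ht : t ∈ stdSimplex ℝ (Fin K)) :
    lowerBoundObjective ε B π j ν t ≤ lowerBoundValue ε B π j ν :=
  le_iSup₂ (f := fun t _ => lowerBoundObjective ε B π j ν t) t ht

/-- The objective is concave on the simplex. -/
theorem lowerBoundObjective_concave {t' : Fin K → ℝ} (ht : t ∈ stdSimplex ℝ (Fin K))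
    (ht' : t' ∈ stdSimplex ℝ (Fin K)) {r r' : ℝ} (hr : 0 ≤ r) (hr' : 0 ≤ r') :
    ENNReal.ofReal r * lowerBoundObjective ε B π j ν t +
      ENNReal.ofReal r' * lowerBoundObjective ε B π j ν t' ≤
        lowerBoundObjective ε B π j ν (r • t + r' • t') := by
  refine le_iInf₂ fun a ha => le_iInf₂ fun x y => le_iInf fun hxy => ?_
  have h (i : Fin K) : ENNReal.ofReal ((r • t + r' • t') i) =
      ENNReal.ofReal r * ENNReal.ofReal (t i) + ENNReal.ofReal r' * ENNReal.ofReal (t' i) := by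
    rw [← ENNReal.ofReal_mul hr, ← ENNReal.ofReal_mul hr',
      ← ENNReal.ofReal_add (mul_nonneg hr (ht.1 i)) (mul_nonneg hr' (ht'.1 i))]
    rfl
  rw [h, h]
  refine (add_le_add (mul_le_mul_right (lowerBoundObjective_le ha hxy) _)
    (mul_le_mul_right (lowerBoundObjective_le ha hxy) _)).trans_eq ?_
  ring

theorem convex_argmax (j : Fin K) (ν : Fin K → ProbabilityMeasure ℝ) :
    Convex ℝ {t | t ∈ stdSimplex ℝ (Fin K) ∧
      lowerBoundObjective ε B π j ν t = lowerBoundValue ε B π j ν} := by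
  rintro t ⟨ht, htV⟩ t' ⟨ht', htV'⟩ r r' hr hr' hrr'
  have hmem := convex_stdSimplex ℝ (Fin K) ht ht' hr hr' hrr'
  refine ⟨hmem, le_antisymm (lowerBoundObjective_le_value hmem) ?_⟩
  have h := lowerBoundObjective_concave (ε := ε) (B := B) (π := π) (j := j) (ν := ν) ht ht' hr hr'
  rwa [htV, htV', ← add_mul, ← ENNReal.ofReal_add hr hr', hrr', ENNReal.ofReal_one, one_mul] at h

theorem tendsto_coord (i : Fin K) :
    Tendsto (fun p : (Fin K → ProbabilityMeasure ℝ) × (Fin K → ℝ) => p.1 i)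
      (𝓝[banditClass K ε B ×ˢ Set.univ] (ν, t)) (𝓝[momentClass ε B] (ν i)) := by
  refine tendsto_nhdsWithin_iff.2 ⟨?_, ?_⟩
  · have : Continuous fun p : (Fin K → ProbabilityMeasure ℝ) × (Fin K → ℝ) => p.1 i := by fun_prop
    exact this.continuousAt.mono_left nhdsWithin_le_nhds
  · filter_upwards [self_mem_nhdsWithin] with p hp
    exact hp.1 i

theorem eventually_ofReal_coord_lt (i : Fin K) {c : ℝ≥0∞} (h : ENNReal.ofReal (t i) < c) :
    ∀ᶠ p : (Fin K → ProbabilityMeasure ℝ) × (Fin K → ℝ) in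
      𝓝[banditClass K ε B ×ˢ Set.univ] (ν, t), ENNReal.ofReal (p.2 i) < c := by
  have hc : Continuous fun p : (Fin K → ProbabilityMeasure ℝ) × (Fin K → ℝ) =>
      ENNReal.ofReal (p.2 i) := ENNReal.continuous_ofReal.comp (by fun_prop)
  exact (hc.continuousAt.mono_left nhdsWithin_le_nhds).eventually_mem (Iio_mem_nhds h)

/-- Strictly between the two CVaRs both divergences are finite and upper semicontinuous; finiteness
avoids the discontinuity of the product at `0 · ∞`. -/
theorem eventually_lt_of_interior (hε : 0 < ε) (hB : 0 < B) (hπ0 : 0 < π) (hπ1 : π < 1)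
    (hν : ν ∈ banditClass K ε B) (haj : a ≠ j) {y : ℝ} (hjy : CVaR π (ν j) < y)
    (hya : y < CVaR π (ν a)) {v : ℝ≥0∞}
    (hv : ENNReal.ofReal (t j) * KLinfU ε B π (ν j) y +
      ENNReal.ofReal (t a) * KLinfL ε B π (ν a) y < v) :
    ∀ᶠ p : (Fin K → ProbabilityMeasure ℝ) × (Fin K → ℝ) in
      𝓝[banditClass K ε B ×ˢ Set.univ] (ν, t), lowerBoundObjective ε B π j p.1 p.2 < v := by
  have hy : y < cvarMax ε B π := hya.trans_le (CVaR_le_cvarMax hε hB hπ0 hπ1 (hν a))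
  have hy' : -B ^ (1 / (1 + ε)) < y := (neg_rpow_le_CVaR hε hB hπ0 hπ1 (hν j)).trans_lt hjy
  obtain ⟨a', ha', u', hu', b', hb', l', hl', hlt⟩ := exists_gt_mul_add_mul_lt
    ENNReal.ofReal_ne_top (KLinfU_lt_top hε hB hπ0 hπ1 (hν j) hy).ne ENNReal.ofReal_ne_top
    (KLinfL_lt_top hε hB hπ0 hπ1 (hν a) hy').ne hv
  obtain ⟨y', hyy', hU⟩ := eventually_KLinfU_lt hε hB hπ0 hπ1 (hν j) hy hu'
  have hL := eventually_KLinfL_lt hε hB hπ0 hπ1 (hν a) hy' hya hl'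
  filter_upwards [(tendsto_coord j).eventually hU, (tendsto_coord a).eventually hL,
    eventually_ofReal_coord_lt j ha', eventually_ofReal_coord_lt a hb'] with p h1 h2 h3 h4
  refine (lowerBoundObjective_le haj hyy'.le).trans_lt (lt_of_le_of_lt ?_ hlt)
  exact add_le_add (mul_le_mul' h3.le h1.le) (mul_le_mul' h4.le h2.le)

/-- The objective is upper semicontinuous at a bandit problem with a unique best arm. -/
theorem eventually_lowerBoundObjective_lt (hε : 0 < ε) (hB : 0 < B) (hπ0 : 0 < π) (hπ1 : π < 1)
    (hν : ν ∈ banditClass K ε B) (hbest : ∀ a, a ≠ j → CVaR π (ν j) < CVaR π (ν a)) {v : ℝ≥0∞}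
    (hv : lowerBoundObjective ε B π j ν t < v) :
    ∀ᶠ p : (Fin K → ProbabilityMeasure ℝ) × (Fin K → ℝ) in
      𝓝[banditClass K ε B ×ˢ Set.univ] (ν, t), lowerBoundObjective ε B π j p.1 p.2 < v := by
  obtain ⟨a, haj, x, y, hxy, hlt⟩ := exists_of_lowerBoundObjective_lt hv
  have hja := hbest a haj
  obtain ⟨y₀, hjy₀, hy₀a⟩ := exists_between hja
  have hmax := CVaR_le_cvarMax hε hB hπ0 hπ1 (hν a)
  -- For `y` at or below the CVaR of `j`, the level moves slightly above it: the `L` term can only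
  -- drop, and the `U` term, zero at that CVaR, stays small.
  rcases le_or_gt y (CVaR π (ν j)) with hyj | hjy
  · have h1 : ENNReal.ofReal (t a) * KLinfL ε B π (ν a) (CVaR π (ν j)) < v := by
      refine lt_of_le_of_lt ?_ hlt
      exact le_add_left (mul_le_mul_right (KLinfL_anti (hxy.trans hyj)) _)
    obtain ⟨l, hl, hlv⟩ := exists_pos_add_mul_lt (b := ENNReal.ofReal (t j))
      ENNReal.ofReal_ne_top h1
    obtain ⟨y', hy', hU⟩ := eventually_KLinfU_lt hε hB hπ0 hπ1 (hν j) (hja.trans_le hmax)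
      (v := l) (by rwa [KLinfU_eq_zero (hν j) le_rfl])
    refine eventually_lt_of_interior hε hB hπ0 hπ1 hν haj (y := min y' y₀) (lt_min hy' hjy₀)
      ((min_le_right _ _).trans_lt hy₀a) (lt_of_le_of_lt ?_ hlv)
    rw [add_comm]
    refine add_le_add (mul_le_mul_right (KLinfL_anti (lt_min hy' hjy₀).le) _)
      (mul_le_mul_right ((KLinfU_mono (min_le_left _ _)).trans ?_) _)
    exact (hU.self_of_nhdsWithin (hν j)).le
  rcases lt_or_ge y (CVaR π (ν a)) with hya | hay
  · refine eventually_lt_of_interior hε hB hπ0 hπ1 hν haj hjy hya (lt_of_le_of_lt ?_ hlt)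
    exact add_le_add le_rfl (mul_le_mul_right (KLinfL_anti hxy) _)
  have h1 : ENNReal.ofReal (t j) * KLinfU ε B π (ν j) (CVaR π (ν a)) < v := by
    refine lt_of_le_of_lt ?_ hlt
    exact le_add_right (mul_le_mul_right (KLinfU_mono hay) _)
  -- Here `y` is at least the CVaR of `a`. If that CVaR is below the maximum, a level `y'` just
  -- above it makes the `L` term vanish for all nearby problems. If it is maximal, no such level is
  -- feasible, and the level moves slightly to the left instead.
  rcases hmax.lt_or_eq with hlt' | heq
  · obtain ⟨a', ha', u', hu', b', hb', l', hl', hlt''⟩ := exists_gt_mul_add_mul_lt (b := 0) (l := 0)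
      (a := ENNReal.ofReal (t j)) ENNReal.ofReal_ne_top
      (KLinfU_lt_top hε hB hπ0 hπ1 (hν j) hlt').ne ENNReal.zero_ne_top ENNReal.zero_ne_top
      (by simpa using h1)
    obtain ⟨y', hyy', hU⟩ := eventually_KLinfU_lt hε hB hπ0 hπ1 (hν j) hlt' hu'
    have hC := (continuousOn_CVaR hε hB.le hπ0 hπ1 _ (hν a)).eventually_mem (Iio_mem_nhds hyy')
    filter_upwards [(tendsto_coord j).eventually hU, (tendsto_coord a).eventually hC,
      eventually_ofReal_coord_lt j ha', self_mem_nhdsWithin] with p h2 h3 h4 h5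
    refine (lowerBoundObjective_le haj (le_refl y')).trans_lt ?_
    rw [KLinfL_eq_zero (h5.1 a) (le_of_lt h3), mul_zero, add_zero]
    exact (mul_le_mul' h4.le h2.le).trans_lt (lt_of_le_of_lt le_self_add hlt'')
  · obtain ⟨l, hl, hlv⟩ := exists_pos_add_mul_lt (b := ENNReal.ofReal (t a))
      ENNReal.ofReal_ne_top h1
    obtain ⟨x₀, hx₀, hx₀l⟩ := exists_KLinfL_lt_of_cvarMax_le hε hB hπ0 hπ1 (hν a) heq.ge hl
    refine eventually_lt_of_interior hε hB hπ0 hπ1 hν haj (y := max x₀ y₀)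
      (hjy₀.trans_le (le_max_right _ _)) (max_lt hx₀ hy₀a) (lt_of_le_of_lt ?_ hlv)
    exact add_le_add (mul_le_mul_right (KLinfU_mono (max_lt hx₀ hy₀a).le) _)
      (mul_le_mul_right ((KLinfL_anti (le_max_left _ _)).trans hx₀l.le) _)

/-- A zero weight may multiply an infinite infimum with no feasible measure behind it. In that case
the measure for the other arm is used twice, which satisfies the CVaR ordering trivially. -/
theorem exists_pair_of_lt (hνj : ν j ∈ momentClass ε B) {x y : ℝ} (hxy : x ≤ y) {v : ℝ≥0∞}
    (h : ENNReal.ofReal (t j) * KLinfU ε B π (ν j) y +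
      ENNReal.ofReal (t a) * KLinfL ε B π (ν a) x < v) :
    ∃ κ ∈ momentClass ε B, ∃ κ' ∈ momentClass ε B, CVaR π κ' ≤ CVaR π κ ∧
      ENNReal.ofReal (t j) * klDiv (ν j : Measure ℝ) (κ : Measure ℝ) +
        ENNReal.ofReal (t a) * klDiv (ν a : Measure ℝ) (κ' : Measure ℝ) < v := by
  have hfinite {p q : ℝ≥0∞} (hp : p ≠ 0) (hpq : p * q < v) : q ≠ ∞ := by
    rintro rfl
    rw [ENNReal.mul_top hp] at hpq
    exact not_top_lt hpq
  have hU := lt_of_le_of_lt le_self_add h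
  have hL := lt_of_le_of_lt le_add_self h
  by_cases hj : ENNReal.ofReal (t j) = 0 <;> by_cases ha : ENNReal.ofReal (t a) = 0
  · refine ⟨ν j, hνj, ν j, hνj, le_rfl, ?_⟩
    rw [hj, ha] at h ⊢
    simpa using h
  · obtain ⟨a', ha', u', hu', b', hb', l', hl', hlt⟩ := exists_gt_mul_add_mul_lt (a := 0) (u := 0)
      ENNReal.zero_ne_top ENNReal.zero_ne_top ENNReal.ofReal_ne_top (hfinite ha hL)
      (by simpa using hL)
    obtain ⟨κ, hκ, -, hκl⟩ := exists_of_KLinfL_lt hl'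
    refine ⟨κ, hκ, κ, hκ, le_rfl, ?_⟩
    rw [hj, zero_mul, zero_add]
    exact (mul_le_mul' hb'.le hκl.le).trans_lt (lt_of_le_of_lt le_add_self hlt)
  · obtain ⟨a', ha', u', hu', b', hb', l', hl', hlt⟩ := exists_gt_mul_add_mul_lt (b := 0) (l := 0)
      ENNReal.ofReal_ne_top (hfinite hj hU) ENNReal.zero_ne_top ENNReal.zero_ne_top
      (by simpa using hU)
    obtain ⟨κ, hκ, -, hκu⟩ := exists_of_KLinfU_lt hu'
    refine ⟨κ, hκ, κ, hκ, le_rfl, ?_⟩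
    rw [ha, zero_mul, add_zero]
    exact (mul_le_mul' ha'.le hκu.le).trans_lt (lt_of_le_of_lt le_self_add hlt)
  · obtain ⟨a', ha', u', hu', b', hb', l', hl', hlt⟩ := exists_gt_mul_add_mul_lt
      ENNReal.ofReal_ne_top (hfinite hj hU) ENNReal.ofReal_ne_top (hfinite ha hL) h
    obtain ⟨κ, hκ, hyκ, hκu⟩ := exists_of_KLinfU_lt hu'
    obtain ⟨κ', hκ', hκx, hκl⟩ := exists_of_KLinfL_lt hl'
    exact ⟨κ, hκ, κ', hκ', hκx.trans (hxy.trans hyκ),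
      (add_le_add (mul_le_mul' ha'.le hκu.le) (mul_le_mul' hb'.le hκl.le)).trans_lt hlt⟩

theorem isCompact_pairs (hε : 0 < ε) (hB : 0 ≤ B) (hπ0 : 0 < π) (hπ1 : π < 1) :
    IsCompact {q : ProbabilityMeasure ℝ × ProbabilityMeasure ℝ |
      q ∈ momentClass ε B ×ˢ momentClass ε B ∧ CVaR π q.2 ≤ CVaR π q.1} := by
  have hK := (isCompact_momentClass hε hB).prod (isCompact_momentClass hε hB)
  have hcl := (isClosed_momentClass hε hB).prod (isClosed_momentClass hε hB)
  have hc := continuousOn_CVaR hε hB hπ0 hπ1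
  refine hK.of_isClosed_subset ?_ fun q hq => hq.1
  have h1 : ContinuousOn (fun q : ProbabilityMeasure ℝ × ProbabilityMeasure ℝ =>
      CVaR π q.1 - CVaR π q.2) (momentClass ε B ×ˢ momentClass ε B) :=
    (hc.comp continuousOn_fst fun q hq => hq.1).sub (hc.comp continuousOn_snd fun q hq => hq.2)
  have h2 := h1.preimage_isClosed_of_isClosed hcl (isClosed_Ici (a := (0 : ℝ)))
  convert h2 using 1
  ext q
  simp

/-- The objective is lower semicontinuous in the bandit problem. -/
theorem eventually_lt_lowerBoundObjective (hε : 0 < ε) (hB : 0 ≤ B) (hπ0 : 0 < π) (hπ1 : π < 1)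
    {v : ℝ≥0∞} (hv : v < lowerBoundObjective ε B π j ν t) :
    ∀ᶠ ν' in 𝓝[banditClass K ε B] ν, v < lowerBoundObjective ε B π j ν' t := by
  -- The pairwise strict bounds only give `≥ v'` for the infimum, so an intermediate value is
  -- needed.
  obtain ⟨v', hvv', hv'⟩ := exists_between hv
  have key (a : Fin K) (ha : a ≠ j) : ∀ᶠ ν' : Fin K → ProbabilityMeasure ℝ in 𝓝 ν,
      ∀ q ∈ {q : ProbabilityMeasure ℝ × ProbabilityMeasure ℝ |
        q ∈ momentClass ε B ×ˢ momentClass ε B ∧ CVaR π q.2 ≤ CVaR π q.1},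
      v' < ENNReal.ofReal (t j) * klDiv (ν' j : Measure ℝ) (q.1 : Measure ℝ) +
        ENNReal.ofReal (t a) * klDiv (ν' a : Measure ℝ) (q.2 : Measure ℝ) := by
    refine (isCompact_pairs hε hB hπ0 hπ1).eventually_forall_of_forall_eventually fun q hq => ?_
    have hlsc (i : Fin K) (f : ProbabilityMeasure ℝ × ProbabilityMeasure ℝ → ProbabilityMeasure ℝ)
        (hf : Continuous f) : LowerSemicontinuous
        fun p : (Fin K → ProbabilityMeasure ℝ) × (ProbabilityMeasure ℝ × ProbabilityMeasure ℝ) =>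
          ENNReal.ofReal (t i) * klDiv (p.1 i : Measure ℝ) (f p.2 : Measure ℝ) := by
      have h1 := (lowerSemicontinuous_klDiv (E := ℝ)).comp (g := fun
        p : (Fin K → ProbabilityMeasure ℝ) × (ProbabilityMeasure ℝ × ProbabilityMeasure ℝ) =>
          (p.1 i, f p.2)) (by fun_prop)
      exact (ENNReal.continuous_const_mul ENNReal.ofReal_ne_top).comp_lowerSemicontinuous h1
        fun _ _ h => mul_le_mul_right h _
    refine ((hlsc j Prod.fst continuous_fst).add (hlsc a Prod.snd continuous_snd)) (ν, q) v'
      (hv'.trans_le ((lowerBoundObjective_le ha hq.2).trans ?_))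
    exact add_le_add (mul_le_mul_right (KLinfU_le hq.1.1 le_rfl) _)
      (mul_le_mul_right (KLinfL_le hq.1.2 le_rfl) _)
  have key' : ∀ᶠ ν' : Fin K → ProbabilityMeasure ℝ in 𝓝 ν, ∀ a, a ≠ j →
      ∀ q ∈ {q : ProbabilityMeasure ℝ × ProbabilityMeasure ℝ |
        q ∈ momentClass ε B ×ˢ momentClass ε B ∧ CVaR π q.2 ≤ CVaR π q.1},
      v' < ENNReal.ofReal (t j) * klDiv (ν' j : Measure ℝ) (q.1 : Measure ℝ) +
        ENNReal.ofReal (t a) * klDiv (ν' a : Measure ℝ) (q.2 : Measure ℝ) :=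
    eventually_all.2 fun a => eventually_imp_distrib_left.2 (key a)
  refine eventually_nhdsWithin_iff.2 (key'.mono fun ν' h hν' => hvv'.trans_le ?_)
  by_contra! hlt
  obtain ⟨a, ha, x, y, hxy, hlt⟩ := exists_of_lowerBoundObjective_lt hlt
  obtain ⟨κ, hκ, κ', hκ', hle, hlt⟩ := exists_pair_of_lt (hν' j) hxy hlt
  exact lt_asymm hlt (h a ha (κ, κ') ⟨⟨hκ, hκ'⟩, hle⟩)

theorem lowerBoundObjective_eq_zero (hν : ν ∈ banditClass K ε B) (haj : a ≠ j)
    (h : CVaR π (ν a) ≤ CVaR π (ν j)) : lowerBoundObjective ε B π j ν t = 0 := by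
  refine le_antisymm ((lowerBoundObjective_le haj (le_refl (CVaR π (ν j)))).trans_eq ?_) zero_le
  rw [KLinfU_eq_zero (hν j) le_rfl, KLinfL_eq_zero (hν a) h]
  simp

end Objective

/-! ### Existence, convexity and stability of optimal weights -/

section OptimalWeights

variable {K : ℕ} {ε B π : ℝ} {ν : Fin K → ProbabilityMeasure ℝ} {j a : Fin K}

theorem optWeights_subset : optWeights ε B π ν ⊆ stdSimplex ℝ (Fin K) := fun _ h => h.1

theorem optWeights_eq_of_unique (hbest : ∀ a, a ≠ j → CVaR π (ν j) < CVaR π (ν a)) :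
    optWeights ε B π ν = {t | t ∈ stdSimplex ℝ (Fin K) ∧
      lowerBoundObjective ε B π j ν t = lowerBoundValue ε B π j ν} := by
  ext t
  refine and_congr_right fun _ => ⟨?_, fun h => ⟨j, fun a => ?_, h⟩⟩
  · rintro ⟨k, hk, h⟩
    have : k = j := by
      by_contra hkj
      exact absurd (hk j) (not_le.2 (hbest k hkj))
    rwa [this] at h
  · rcases eq_or_ne a j with rfl | ha
    · exact le_rfl
    · exact (hbest a ha).le

theorem optWeights_eq_stdSimplex (hν : ν ∈ banditClass K ε B) (hj : IsBestArm π ν j) (haj : a ≠ j)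
    (h : CVaR π (ν a) ≤ CVaR π (ν j)) : optWeights ε B π ν = stdSimplex ℝ (Fin K) := by
  refine optWeights_subset.antisymm fun t ht => ⟨ht, j, hj, ?_⟩
  rw [lowerBoundValue]
  simp [lowerBoundObjective_eq_zero hν haj h]

theorem exists_isBestArm (hK : 0 < K) (π : ℝ) (ν : Fin K → ProbabilityMeasure ℝ) :
    ∃ j, IsBestArm π ν j := by
  have : Nonempty (Fin K) := ⟨⟨0, hK⟩⟩
  exact Finite.exists_min fun a => CVaR π (ν a)

theorem stdSimplex_nonempty (hK : 0 < K) : (stdSimplex ℝ (Fin K)).Nonempty :=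
  ⟨_, single_mem_stdSimplex ℝ ⟨0, hK⟩⟩

/-- A bandit problem has a unique best arm, or all weights are optimal. -/
theorem unique_or_optWeights_eq (hK : 0 < K) (hν : ν ∈ banditClass K ε B) :
    (∃ j, ∀ a, a ≠ j → CVaR π (ν j) < CVaR π (ν a)) ∨
      optWeights ε B π ν = stdSimplex ℝ (Fin K) := by
  obtain ⟨j, hj⟩ := exists_isBestArm hK π ν
  by_cases h : ∀ a, a ≠ j → CVaR π (ν j) < CVaR π (ν a)
  · exact Or.inl ⟨j, h⟩
  · push Not at h
    obtain ⟨a, haj, ha⟩ := h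
    exact Or.inr (optWeights_eq_stdSimplex hν hj haj ha)

/-- With a unique best arm, an upper semicontinuous function on the compact simplex attains its
maximum. -/
theorem optWeights_nonempty (hK : 0 < K) (hε : 0 < ε) (hB : 0 < B) (hπ0 : 0 < π) (hπ1 : π < 1)
    (hν : ν ∈ banditClass K ε B) : (optWeights ε B π ν).Nonempty := by
  rcases unique_or_optWeights_eq (π := π) hK hν with ⟨j, hj⟩ | h
  · have husc : UpperSemicontinuousOn (fun t => lowerBoundObjective ε B π j ν t)
        (stdSimplex ℝ (Fin K)) := by
      intro t _ v hv
      have h := eventually_lowerBoundObjective_lt hε hB hπ0 hπ1 hν hj hv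
      have ht : Tendsto (fun t' : Fin K → ℝ => (ν, t')) (𝓝[stdSimplex ℝ (Fin K)] t)
          (𝓝[banditClass K ε B ×ˢ Set.univ] (ν, t)) := by
        refine tendsto_nhdsWithin_iff.2 ⟨?_, Eventually.of_forall fun _ => ⟨hν, trivial⟩⟩
        exact (Continuous.prodMk_right ν).continuousAt.mono_left nhdsWithin_le_nhds
      exact ht.eventually h
    obtain ⟨t, ht, hmax⟩ := husc.exists_isMaxOn (stdSimplex_nonempty hK)
      (isCompact_stdSimplex ℝ (Fin K))
    rw [optWeights_eq_of_unique hj]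
    exact ⟨t, ht, le_antisymm (lowerBoundObjective_le_value ht) (iSup₂_le fun s hs => hmax hs)⟩
  · rw [h]
    exact stdSimplex_nonempty hK

theorem convex_optWeights (hK : 0 < K) (hν : ν ∈ banditClass K ε B) :
    Convex ℝ (optWeights ε B π ν) := by
  rcases unique_or_optWeights_eq (π := π) hK hν with ⟨j, hj⟩ | h
  · rw [optWeights_eq_of_unique hj]
    exact convex_argmax j ν
  · rw [h]
    exact convex_stdSimplex ℝ (Fin K)

theorem eventually_unique (hε : 0 < ε) (hB : 0 < B) (hπ0 : 0 < π) (hπ1 : π < 1)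
    (hν : ν ∈ banditClass K ε B) (hj : ∀ a, a ≠ j → CVaR π (ν j) < CVaR π (ν a)) :
    ∀ᶠ ν' in 𝓝[banditClass K ε B] ν, ∀ a, a ≠ j → CVaR π (ν' j) < CVaR π (ν' a) := by
  have hc (i : Fin K) : Tendsto (fun ν' : Fin K → ProbabilityMeasure ℝ => CVaR π (ν' i))
      (𝓝[banditClass K ε B] ν) (𝓝 (CVaR π (ν i))) := by
    refine (continuousOn_CVaR hε hB.le hπ0 hπ1 (ν i) (hν i)).tendsto.comp
      (tendsto_nhdsWithin_iff.2 ⟨?_, ?_⟩)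
    · exact (continuous_apply i).continuousAt.mono_left nhdsWithin_le_nhds
    · filter_upwards [self_mem_nhdsWithin] with ν' hν'
      exact hν' i
  exact eventually_all.2 fun a => eventually_imp_distrib_left.2 fun ha =>
    (hc j).eventually_lt (hc a) (hj a ha)

/-- Each `t` outside `O` is beaten at `ν` by some `s`, with a value `v` in between. Near `(ν, t)`
the objective stays below `v`, while at the fixed `s` it stays above `v`. Compactness of the simplex
minus `O` makes the neighbourhood of `ν` uniform in `t`. -/
theorem eventually_optWeights_subset (hK : 0 < K) (hε : 0 < ε) (hB : 0 < B) (hπ0 : 0 < π)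
    (hπ1 : π < 1) (hν : ν ∈ banditClass K ε B) {O : Set (Fin K → ℝ)} (hO : IsOpen O)
    (hsub : optWeights ε B π ν ⊆ O) :
    ∀ᶠ ν' in 𝓝[banditClass K ε B] ν, optWeights ε B π ν' ⊆ O := by
  rcases unique_or_optWeights_eq (π := π) hK hν with ⟨j, hj⟩ | h
  swap
  · exact Eventually.of_forall fun ν' => optWeights_subset.trans (h ▸ hsub)
  rw [optWeights_eq_of_unique hj] at hsub
  have hcomp : IsCompact (stdSimplex ℝ (Fin K) \ O) := (isCompact_stdSimplex ℝ (Fin K)).diff hO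
  have key : ∀ᶠ ν' in 𝓝 ν, ∀ t ∈ stdSimplex ℝ (Fin K) \ O, ν' ∈ banditClass K ε B →
      lowerBoundObjective ε B π j ν' t < lowerBoundValue ε B π j ν' := by
    refine hcomp.eventually_forall_of_forall_eventually fun t ht => ?_
    have hlt : lowerBoundObjective ε B π j ν t < lowerBoundValue ε B π j ν :=
      (lowerBoundObjective_le_value ht.1).lt_of_ne fun heq => ht.2 (hsub ⟨ht.1, heq⟩)
    obtain ⟨s, hs, hts⟩ := lt_biSup_iff.1 hlt
    obtain ⟨v, htv, hvs⟩ := exists_between hts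
    have h1 := eventually_nhdsWithin_iff.1
      (eventually_lowerBoundObjective_lt hε hB hπ0 hπ1 hν hj htv)
    have h2 := eventually_nhdsWithin_iff.1
      (eventually_lt_lowerBoundObjective hε hB.le hπ0 hπ1 hvs)
    filter_upwards [h1, continuous_fst.continuousAt.eventually h2] with p h1 h2 hp
    exact (h1 ⟨hp, trivial⟩).trans ((h2 hp).trans_le (lowerBoundObjective_le_value hs))
  filter_upwards [nhdsWithin_le_nhds key, self_mem_nhdsWithin,
    eventually_unique hε hB hπ0 hπ1 hν hj] with ν' h1 hν' h2
  rw [optWeights_eq_of_unique h2]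
  rintro t ⟨ht, heq⟩
  by_contra htO
  exact (h1 t ⟨ht, htO⟩ hν').ne heq

end OptimalWeights

end CVaRBandit

end

theorem lemma3 (K : ℕ) (hK : 2 ≤ K) (ε B π : ℝ) (hε : 0 < ε) (hB : 0 < B)
    (hπ0 : 0 < π) (hπ1 : π < 1) :
    UpperHemicontinuousOn
        (fun ν : Fin K → ProbabilityMeasure ℝ => CVaRBandit.optWeights ε B π ν)
        (CVaRBandit.banditClass K ε B) ∧
      (∀ ν ∈ CVaRBandit.banditClass K ε B, (CVaRBandit.optWeights ε B π ν).Nonempty) ∧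
      (∀ ν ∈ CVaRBandit.banditClass K ε B, Convex ℝ (CVaRBandit.optWeights ε B π ν)) := by
  have hK0 : 0 < K := by omega
  refine ⟨?_, fun ν hν => CVaRBandit.optWeights_nonempty hK0 hε hB hπ0 hπ1 hν,
    fun ν hν => CVaRBandit.convex_optWeights hK0 hν⟩
  rw [upperHemicontinuousOn_iff]
  intro ν hν
  rw [upperHemicontinuousWithinAt_iff]
  intro W hW
  obtain ⟨O, hO, hsub, hOW⟩ := mem_nhdsSet_iff_exists.1 hW
  filter_upwards [CVaRBandit.eventually_optWeights_subset hK0 hε hB hπ0 hπ1 hν hO hsub] with ν' h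
  exact mem_nhdsSet_iff_exists.2 ⟨O, hO, h, hOW⟩
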